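/- Let $k$ be a field and let $G$ be a finite simple graph (not necessarily connected) with vertex set $V(G)$ and edge set $E(G)$. The toric ideal of $G$ is the kernel $P_G$ of the $k$-algebra homomorphism $k[x_e : e\in E(G)]\to k[t_v : v\in V(G)]$, $x_{\{u,v\}}\mapsto t_ut_v$, and $G$ is called a complete intersection if the minimal number of generators $\mu(P_G)$ equals the height $\mathrm{ht}(P_G)$. For a closed walk $w=(v_0,v_1,\ldots,v_{2q}=v_0)$ with edges $e_j=\{v_{j-1},v_j\}$ put $B_w=\prod_{l=1}^q x_{e_{2l-1}}-\prod_{l=1}^q x_{e_{2l}}$. A graph with $2r$ distinct vertices $a_1,\ldots,a_r,b_1,\ldots,b_r$ $(r\ge 1)$ is a band (respectively, a Möbius band) if its edges are $\{a_i,a_{i+1}\}$ and $\{b_i,b_{i+1}\}$ for $1\le i<r$, $\{a_j,b_j\}$ for $1\le j\le r$, and $\{a_1,a_r\},\{b_1,b_r\}$ (respectively, $\{a_1,b_r\},\{a_r,b_1\}$). It is odd or even according to the parity of $r$. Let $G$ be $3$-regular. Then: (1) $G$ is a complete intersection if and only if every connected component of $G$ is an odd band or an even Möbius band. (2) If $G$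 is an odd band with vertices $a_1,\ldots,a_r,b_1,\ldots,b_r$ as above, then $\{B_{w_1},\ldots,B_{w_r}\}$ is a minimal set of generators of $P_G$ consisting of $r$ distinct quadrics, where $w_i=(a_i,b_i,b_{i+1},a_{i+1},a_i)$ for $1\le i\le r-1$ and $w_r=(a_1,b_1,b_r,a_r,a_1)$. (3) If $G$ is an even Möbius band with vertices $a_1,\ldots,a_r,b_1,\ldots,b_r$ as above, then $\{B_{w_1},\ldots,B_{w_r}\}$ is a minimal set of generators of $P_G$ consisting of $r$ distinct quadrics, where $w_i=(a_i,b_i,b_{i+1},a_{i+1},a_i)$ for $1\le i\le r-1$ and $w_r=(a_1,b_1,a_r,b_r,a_1)$. (4) If every connected component of $G$ is an odd band or an even Möbius band, then, for any choice of such labellings of the vertices of the components, the union over the components of the sets of quadrics in (2) and (3) is a minimal set of generators of $P_G$. Here a minimal set of generators is one of which no proper subset generates the ideal and which has the least possible number $\mu(P_G)$ of elements. -/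

import Mathlib

namespace ToricGraph

section Toric

/-- The toric ideal of a matrix `A` with entries in `ℕ`: the kernel of the `k`-algebra homomorphism
`k[x_j] → k[t_i]` that sends `x_j` to `t ^ a_j`, where `a_j` is the `j`-th column of `A`. -/
noncomputable def toricIdeal (k : Type*) [Field k] {m n : Type*} [Fintype m] (A : Matrix m n ℕ) :
    Ideal (MvPolynomial n k) :=
  RingHom.ker (MvPolynomial.aeval (R := k)
    (fun j : n => ∏ i : m, (MvPolynomial.X i : MvPolynomial m k) ^ A i j))

/-- The minimal number of generators of `I` equals the height of `I`
(used for ideals of Noetherian rings only). -/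
def IsCompleteIntersection {R : Type*} [CommRing R] (I : Ideal R) : Prop :=
  (Submodule.spanFinrank I : ℕ∞) = I.height

/-- `S` generates `I`, no proper subset of `S` generates `I`, and no generating set of `I` has fewer
elements than `S`. -/
structure IsMinimalGeneratingSet {R : Type*} [CommRing R] (I : Ideal R) (S : Set R) : Prop where
  span_eq : Ideal.span S = I
  irredundant : ∀ T : Set R, T ⊂ S → Ideal.span T ≠ I
  encard_le : ∀ T : Set R, Ideal.span T = I → S.encard ≤ T.encard

end Toric

section Graphs

variable {V : Type*}

open Classical in
/-- The incidence matrix of `G`: rows indexed by the vertices, columns by the edges of `G`. -/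
noncomputable def incidence (G : SimpleGraph V) : Matrix V G.edgeSet ℕ :=
  (G.incMatrix ℕ).submatrix id Subtype.val

/-- The toric ideal `P_G` of the graph `G`, in the polynomial ring with one variable per edge. -/
noncomputable def graphIdeal (k : Type*) [Field k] [Fintype V] (G : SimpleGraph V) :
    Ideal (MvPolynomial G.edgeSet k) :=
  toricIdeal k (incidence G)

/-- The pair (product of the variables of the 1st, 3rd, 5th, … edges of the walk,
product of the variables of its 2nd, 4th, 6th, … edges). -/
noncomputable def walkMonomials (k : Type*) [Field k] {G : SimpleGraph V} :
    {u v : V} → G.Walk u v → MvPolynomial G.edgeSet k × MvPolynomial G.edgeSet k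
  | _, _, .nil => (1, 1)
  | u, _, .cons (v := v) h p =>
      (MvPolynomial.X ⟨s(u, v), h⟩ * (walkMonomials k p).2, (walkMonomials k p).1)

/-- The binomial `B_w` of a walk `w` (of interest when `w` is closed of even length). -/
noncomputable def walkBinomial (k : Type*) [Field k] {G : SimpleGraph V} {u v : V}
    (w : G.Walk u v) : MvPolynomial G.edgeSet k :=
  (walkMonomials k w).1 - (walkMonomials k w).2

/-- The edges `{a_i, a_{i+1}}`, `{b_i, b_{i+1}}` and `{a_j, b_j}` of the chain on the vertices
`a_1, …, a_r, b_1, …, b_r`, where `r = n + 1` and the indices are shifted to `0, …, n`. -/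
def chainEdges {n : ℕ} (a b : Fin (n + 1) → V) : Set (Sym2 V) :=
  {e | (∃ i : Fin n, e = s(a i.castSucc, a i.succ) ∨ e = s(b i.castSucc, b i.succ)) ∨
    ∃ j : Fin (n + 1), e = s(a j, b j)}

/-- `G` is a band with vertices `a_1, …, a_r, b_1, …, b_r` (all distinct), `r = n + 1`. -/
structure IsBand (G : SimpleGraph V) {n : ℕ} (a b : Fin (n + 1) → V) : Prop where
  bijective : Function.Bijective (Sum.elim a b)
  edgeSet_eq : G.edgeSet =
    chainEdges a b ∪ {s(a 0, a (Fin.last n)), s(b 0, b (Fin.last n))}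

/-- `G` is a Möbius band with vertices `a_1, …, a_r, b_1, …, b_r` (all distinct), `r = n + 1`. -/
structure IsMobiusBand (G : SimpleGraph V) {n : ℕ} (a b : Fin (n + 1) → V) : Prop where
  bijective : Function.Bijective (Sum.elim a b)
  edgeSet_eq : G.edgeSet =
    chainEdges a b ∪ {s(a 0, b (Fin.last n)), s(a (Fin.last n), b 0)}

/-- `G` is a band with `r = n + 1` odd. -/
def IsOddBand (G : SimpleGraph V) : Prop :=
  ∃ (n : ℕ) (a b : Fin (n + 1) → V), Odd (n + 1) ∧ IsBand G a b

/-- `G` is a Möbius band with `r = n + 1` even. -/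
def IsEvenMobiusBand (G : SimpleGraph V) : Prop :=
  ∃ (n : ℕ) (a b : Fin (n + 1) → V), Even (n + 1) ∧ IsMobiusBand G a b

/-- The binomials of the closed walks `w_i = (a_i, b_i, b_{i+1}, a_{i+1}, a_i)`, `1 ≤ i < r`, and
`w_r = (a_1, b_1, b_r, a_r, a_1)` of `G`. A walk is given by its list of vertices. -/
def bandQuadrics (k : Type*) [Field k] (G : SimpleGraph V) {n : ℕ} (a b : Fin (n + 1) → V) :
    Set (MvPolynomial G.edgeSet k) :=
  {f | ∃ (u : V) (w : G.Walk u u), f = walkBinomial k w ∧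
    ((∃ i : Fin n, w.support = [a i.castSucc, b i.castSucc, b i.succ, a i.succ, a i.castSucc]) ∨
      w.support = [a 0, b 0, b (Fin.last n), a (Fin.last n), a 0])}

/-- The binomials of the closed walks `w_i = (a_i, b_i, b_{i+1}, a_{i+1}, a_i)`, `1 ≤ i < r`, and
`w_r = (a_1, b_1, a_r, b_r, a_1)` of `G`. A walk is given by its list of vertices. -/
def mobiusQuadrics (k : Type*) [Field k] (G : SimpleGraph V) {n : ℕ} (a b : Fin (n + 1) → V) :
    Set (MvPolynomial G.edgeSet k) :=
  {f | ∃ (u : V) (w : G.Walk u u), f = walkBinomial k w ∧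
    ((∃ i : Fin n, w.support = [a i.castSucc, b i.castSucc, b i.succ, a i.succ, a i.castSucc]) ∨
      w.support = [a 0, b 0, a (Fin.last n), b (Fin.last n), a 0])}

/-- `S` is the set of explicit quadrics of the component `c` of `G` for some way of writing `c` as an
odd band or as an even Möbius band. -/
def IsComponentQuadrics (k : Type*) [Field k] {G : SimpleGraph V} (c : G.ConnectedComponent)
    (S : Set (MvPolynomial G.edgeSet k)) : Prop :=
  ∃ (n : ℕ) (a b : Fin (n + 1) → c),
    (Odd (n + 1) ∧ IsBand c.toSimpleGraph a b ∧
        S = bandQuadrics k G (fun i => (a i : V)) (fun i => (b i : V))) ∨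
      (Even (n + 1) ∧ IsMobiusBand c.toSimpleGraph a b ∧
        S = mobiusQuadrics k G (fun i => (a i : V)) (fun i => (b i : V)))

end Graphs

end ToricGraph

namespace ToricGraph

/-! ### Toric ideals: binomial generators and the height as a lattice rank. -/

section ToricTheory

/-! The height of `P_G` is the rank of the lattice `L` of integral edge weightings whose sum at
every vertex is zero (`height_toricIdeal`). For a cubic graph `2|E| = 3|V|`, so this rank is at
least `|E| - |V| = |V|/2`.

Let `P_G` be a complete intersection. Graded Nakayama gives at most as many minimal binomial
generators as the height, and their exponent differences span `L`, so they form a basis of `L`. For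
each vertex `v`, the generators avoiding `v` span the part of `L` that vanishes on the edges at `v`
(`mem_span_expDiff_of_vanishing`). The generators through `v` therefore stay independent when
restricted to those edges. There the vertex relation leaves rank two, so at most two generators pass
through `v`. On the other hand a minimal binomial meets at least four vertices, with equality only
for the quadric of a 4-cycle. Double counting with `r ≥ |V|/2` makes every inequality an equality:
all generators are quadrics of 4-cycles, two through each vertex, and `L` has rank exactly `|E| -
|V|`.

By independence the two 4-cycles at a vertex cover its three edges, so they share exactly one, the
rung. The rungs form a perfect matching `τ` preserving the other edges, the sides. Following sides
until a rung is met again exhibits each component as a band or a Möbius band. With the wrong parity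
the component would be bipartite, which would make the rank of `L` too large
(`eq_zero_of_forall_adj_add_eq_zero`).

Conversely, disjoint unions of odd bands and even Möbius bands are treated at once as ladders
`IsLadder`. The 4-cycle quadrics rewrite a pair of opposite sides into rungs. The parity condition
forces lattice vectors to agree on opposite sides, so two reduced monomials with the same image
coincide and the quadrics generate. There are at most `|V|/2` of them, which is at most the height,
so they are a minimal generating set and `P_G` is a complete intersection. -/

theorem finrank_range_add_finrank_ker_int {M N : Type*} [AddCommGroup M] [AddCommGroup N]
    [Module.Finite ℤ M] (f : M →ₗ[ℤ] N) :
    Module.finrank ℤ (LinearMap.range f) + Module.finrank ℤ (LinearMap.ker f) =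
      Module.finrank ℤ M := by
  rw [← f.quotKerEquivRange.finrank_eq, Submodule.finrank_quotient_add_finrank]

open MvPolynomial

variable {k : Type*} [Field k] {m n : Type*} [Fintype n]

/-- The lattice of integral relations between the columns of `A`. -/
def relationLattice (A : Matrix m n ℕ) : Submodule ℤ (n → ℤ) :=
  LinearMap.ker (A.map (Nat.cast : ℕ → ℤ)).mulVecLin

theorem mem_relationLattice {A : Matrix m n ℕ} {u : n → ℤ} :
    u ∈ relationLattice A ↔ ∀ i, ∑ j, (A i j : ℤ) * u j = 0 := by
  simp only [relationLattice, LinearMap.mem_ker, Matrix.mulVecLin_apply, funext_iff]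
  rfl

/-- The integral vector `α - β`. -/
def expDiff (α β : n →₀ ℕ) : n → ℤ := fun j => (α j : ℤ) - β j

theorem mulVec_eq_iff {A : Matrix m n ℕ} {α β : n →₀ ℕ} :
    A.mulVec α = A.mulVec β ↔ expDiff α β ∈ relationLattice A := by
  simp only [mem_relationLattice, funext_iff, Matrix.mulVec, dotProduct, expDiff, mul_sub,
    Finset.sum_sub_distrib, sub_eq_zero]
  exact forall_congr' fun i => by norm_cast

theorem exists_expDiff_eq (u : n → ℤ) :
    ∃ α β : n →₀ ℕ, expDiff α β = u ∧ ∀ j, u j = 0 → α j = 0 ∧ β j = 0 := by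
  refine ⟨Finsupp.equivFunOnFinite.symm fun j => (u j).toNat,
    Finsupp.equivFunOnFinite.symm fun j => (-u j).toNat, ?_, fun j hj => by simp [hj]⟩
  ext j; simp [expDiff]

/-- The matrix `A` with one more row, the `e`-th unit vector. -/
def addUnitRow [DecidableEq n] (A : Matrix m n ℕ) (e : n) : Matrix (Option m) n ℕ
  | none, j => if j = e then 1 else 0
  | some i, j => A i j

theorem mem_relationLattice_addUnitRow [DecidableEq n] {A : Matrix m n ℕ} {e : n} {u : n → ℤ} :
    u ∈ relationLattice (addUnitRow A e) ↔ u ∈ relationLattice A ∧ u e = 0 := by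
  simp [mem_relationLattice, Option.forall, addUnitRow, and_comm]

variable [Fintype m]

theorem aeval_monomial (A : Matrix m n ℕ) (α : n →₀ ℕ) (c : k) :
    aeval (R := k) (fun j : n => ∏ i : m, (X i : MvPolynomial m k) ^ A i j) (monomial α c) =
      monomial (Finsupp.equivFunOnFinite.symm (A.mulVec α)) c := by
  rw [MvPolynomial.aeval_monomial, Finsupp.prod_fintype _ _ (fun i => pow_zero _),
    monomial_eq, Finsupp.prod_fintype _ _ (fun i => pow_zero _), algebraMap_eq]
  congr 1
  simp_rw [← Finset.prod_pow]
  rw [Finset.prod_comm]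
  refine Finset.prod_congr rfl fun i _ => ?_
  simp_rw [← pow_mul]
  rw [Finset.prod_pow_eq_pow_sum]
  rfl

theorem binomial_mem_toricIdeal {A : Matrix m n ℕ} {α β : n →₀ ℕ} :
    (monomial α 1 - monomial β 1 : MvPolynomial n k) ∈ toricIdeal k A ↔
      A.mulVec α = A.mulVec β := by
  rw [toricIdeal, RingHom.mem_ker, map_sub, sub_eq_zero]
  erw [aeval_monomial, aeval_monomial]
  rw [monomial_left_inj one_ne_zero, EmbeddingLike.apply_eq_iff_eq]

instance toricIdeal_isPrime (A : Matrix m n ℕ) : (toricIdeal k A).IsPrime :=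
  RingHom.ker_isPrime _

theorem monomial_notMem_toricIdeal (A : Matrix m n ℕ) (α : n →₀ ℕ) :
    (monomial α 1 : MvPolynomial n k) ∉ toricIdeal k A := by
  rw [toricIdeal, RingHom.mem_ker]
  erw [aeval_monomial]
  simp

/-- The binomials of the toric ideal. -/
def toricBinomials (k : Type*) [Field k] (A : Matrix m n ℕ) : Set (MvPolynomial n k) :=
  {f | ∃ α β : n →₀ ℕ, A.mulVec α = A.mulVec β ∧ f = monomial α 1 - monomial β 1}

/-- Choosing one monomial in each fibre of the monomial map `φ` defines a linear map `ψ` backwards.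
Each monomial differs from its image under `ψ ∘ φ` by a toric binomial, so `f - ψ (φ f)` lies in the
span for every `f`; on the kernel this is `f` itself. -/
theorem toricIdeal_eq_span (A : Matrix m n ℕ) :
    toricIdeal k A = Ideal.span (toricBinomials k A) := by
  classical
  refine le_antisymm (fun f hf => ?_) (Ideal.span_le.2 ?_)
  · let φ : MvPolynomial n k →ₐ[k] MvPolynomial m k :=
      aeval (R := k) (fun j : n => ∏ i : m, (X i : MvPolynomial m k) ^ A i j)
    let rep : (m →₀ ℕ) → (n →₀ ℕ) := fun d =>
      if h : ∃ α : n →₀ ℕ, A.mulVec α = d then h.choose else 0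
    let ψ : MvPolynomial m k →ₗ[k] MvPolynomial n k :=
      (basisMonomials m k).constr k fun d => monomial (rep d) 1
    have hψ : ∀ d c, ψ (monomial d c) = monomial (rep d) c := by
      intro d c
      have : (monomial d c : MvPolynomial m k) = c • basisMonomials m k d := by
        simp [smul_monomial]
      rw [this, map_smul, Module.Basis.constr_basis, smul_monomial, smul_eq_mul, mul_one]
    have key : ∀ g : MvPolynomial n k, g - ψ (φ g) ∈ Ideal.span (toricBinomials k A) := by
      intro g
      induction g using MvPolynomial.induction_on' with
      | monomial α c =>
        have hφ : φ (monomial α c) =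
          monomial (Finsupp.equivFunOnFinite.symm (A.mulVec α)) c := aeval_monomial A α c
        rw [hφ, hψ]
        set β := rep (Finsupp.equivFunOnFinite.symm (A.mulVec α)) with hβ
        have hαβ : A.mulVec α = A.mulVec β := by
          have h : ∃ γ : n →₀ ℕ, A.mulVec γ = (Finsupp.equivFunOnFinite.symm (A.mulVec α)) :=
            ⟨α, by simp⟩
          rw [hβ]
          simp only [rep, dif_pos h]
          rw [h.choose_spec]
          simp
        have : (monomial α c - monomial β c : MvPolynomial n k) =
            C c * (monomial α 1 - monomial β 1) := by
          simp [mul_sub, C_mul_monomial]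
        rw [this]
        exact Ideal.mul_mem_left _ _ (Ideal.subset_span ⟨α, β, hαβ, rfl⟩)
      | add p q hp hq =>
        have : p + q - ψ (φ (p + q)) = (p - ψ (φ p)) + (q - ψ (φ q)) := by
          rw [map_add, map_add]; ring
        rw [this]
        exact add_mem hp hq
    have h0 : φ f = 0 := hf
    simpa [h0] using key f
  · rintro _ ⟨α, β, h, rfl⟩
    exact binomial_mem_toricIdeal.2 h

/-- The height of a toric ideal is at most the rank of its lattice. -/
theorem height_toricIdeal_le (A : Matrix m n ℕ) :
    (toricIdeal k A).height ≤ Module.finrank ℤ (relationLattice A) := by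
  classical
  let b := Module.finBasis ℤ (relationLattice A)
  let pos : Fin (Module.finrank ℤ (relationLattice A)) → n →₀ ℕ := fun i =>
    Finsupp.equivFunOnFinite.symm fun j => ((b i : n → ℤ) j).toNat
  let neg : Fin (Module.finrank ℤ (relationLattice A)) → n →₀ ℕ := fun i =>
    Finsupp.equivFunOnFinite.symm fun j => (-(b i : n → ℤ) j).toNat
  have hb : ∀ i, expDiff (pos i) (neg i) = b i := by
    intro i; ext j; simp [expDiff, pos, neg]
  let F : Fin (Module.finrank ℤ (relationLattice A)) → MvPolynomial n k := fun i =>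
    monomial (pos i) 1 - monomial (neg i) 1
  -- The toric ideal is a minimal prime over the ideal of a lattice basis, so Krull's height theorem
  -- applies. The vectors represented by some binomial of a prime `Q` in between form a subgroup
  -- containing the basis, hence all of the lattice.
  have hmin : toricIdeal k A ∈ (Ideal.span (Set.range F)).minimalPrimes := by
    refine ⟨⟨inferInstance, ?_⟩, ?_⟩
    · rw [Ideal.span_le]
      rintro _ ⟨i, rfl⟩
      refine binomial_mem_toricIdeal.2 (mulVec_eq_iff.2 ?_)
      rw [hb]; exact (b i).2
    · rintro Q ⟨hQ, hJQ⟩ hQP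
      have hlat : ∀ u ∈ relationLattice A, ∃ α β : n →₀ ℕ, expDiff α β = u ∧
          (monomial α 1 - monomial β 1 : MvPolynomial n k) ∈ Q := by
        intro u hu
        have hu' : (⟨u, hu⟩ : relationLattice A) ∈ Submodule.span ℤ (Set.range b) := by
          rw [b.span_eq]; trivial
        have : ∀ w ∈ Submodule.span ℤ (Set.range b), ∃ α β : n →₀ ℕ, expDiff α β = w ∧
            (monomial α 1 - monomial β 1 : MvPolynomial n k) ∈ Q := by
          intro w hw
          rw [← Submodule.mem_toAddSubgroup, Submodule.span_int_eq_addSubgroupClosure] at hw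
          induction hw using AddSubgroup.closure_induction with
          | mem x hx =>
            obtain ⟨i, rfl⟩ := hx
            exact ⟨pos i, neg i, hb i, hJQ (Ideal.subset_span ⟨i, rfl⟩)⟩
          | zero => exact ⟨0, 0, by ext; simp [expDiff], by simp⟩
          | add x y _ _ hx hy =>
            obtain ⟨α, β, h1, h2⟩ := hx
            obtain ⟨α', β', h1', h2'⟩ := hy
            refine ⟨α + α', β + β', ?_, ?_⟩
            · rw [Submodule.coe_add, ← h1, ← h1']; ext; simp [expDiff]; ring
            · have : (monomial (α + α') 1 - monomial (β + β') 1 : MvPolynomial n k) =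
                  monomial α 1 * (monomial α' 1 - monomial β' 1) +
                  monomial β' 1 * (monomial α 1 - monomial β 1) := by
                simp only [mul_sub, monomial_mul, mul_one, add_comm β' α, add_comm β' β]
                ring
              rw [this]
              exact add_mem (Ideal.mul_mem_left _ _ h2') (Ideal.mul_mem_left _ _ h2)
          | neg x _ hx =>
            obtain ⟨α, β, h1, h2⟩ := hx
            refine ⟨β, α, ?_, ?_⟩
            · rw [Submodule.coe_neg, ← h1]; ext; simp [expDiff]
            · rw [← neg_sub]; exact neg_mem h2
        exact this _ hu'
      rw [toricIdeal_eq_span, Ideal.span_le]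
      rintro _ ⟨α, β, h, rfl⟩
      obtain ⟨α', β', h1, h2⟩ := hlat _ (mulVec_eq_iff.1 h)
      -- Two binomials with the same exponent difference agree up to monomial factors, and `Q`
      -- contains no monomial because it lies inside the toric ideal.
      have hadd : α + β' = α' + β := by
        ext j
        have := congrFun h1 j
        simp only [expDiff] at this
        simp only [Finsupp.coe_add, Pi.add_apply]
        omega
      have : (monomial β' 1 * (monomial α 1 - monomial β 1) : MvPolynomial n k) =
          monomial β 1 * (monomial α' 1 - monomial β' 1) := by
        simp only [mul_sub, monomial_mul, mul_one, add_comm β' α, hadd, add_comm β' β,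
          add_comm β α']
      have hmem := Ideal.mul_mem_left Q (monomial β 1) h2
      rw [← this] at hmem
      exact (hQ.mem_or_mem hmem).resolve_left fun h' => monomial_notMem_toricIdeal A β' (hQP h')
  refine (Ideal.height_le_card_of_mem_minimalPrimes_span (Set.finite_range F) hmin).trans ?_
  rw [← Nat.card_coe_set_eq]
  exact_mod_cast (Finite.card_range_le F).trans (by simp)

theorem toricIdeal_mono {m' : Type*} [Fintype m'] {A : Matrix m n ℕ} {B : Matrix m' n ℕ}
    (h : relationLattice B ≤ relationLattice A) : toricIdeal k B ≤ toricIdeal k A := by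
  rw [toricIdeal_eq_span B, Ideal.span_le]
  rintro _ ⟨α, β, hαβ, rfl⟩
  exact binomial_mem_toricIdeal.2 (mulVec_eq_iff.2 (h (mulVec_eq_iff.1 hαβ)))

/-- Requiring one coordinate `e` to vanish, by adding a unit row to the matrix, lowers the rank of
the lattice by at most one. If some lattice vector is nonzero at `e`, the toric ideal becomes
strictly smaller, and it remains prime. Iteration gives a chain of primes. -/
theorem le_height_toricIdeal_of_le_finrank (d : ℕ) :
    ∀ {m : Type*} [Fintype m] (A : Matrix m n ℕ), d ≤ Module.finrank ℤ (relationLattice A) →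
      (d : ℕ∞) ≤ (toricIdeal k A).height := by
  classical
  induction d with
  | zero => intros; simp
  | succ d ih =>
    intro m _ A hd
    have hne : relationLattice A ≠ ⊥ := by
      intro h; rw [h, finrank_bot] at hd; omega
    obtain ⟨u, hu, hu0⟩ := Submodule.exists_mem_ne_zero_of_ne_bot hne
    obtain ⟨e, he⟩ := Function.ne_iff.1 hu0
    let B := addUnitRow A e
    have hle : relationLattice B ≤ relationLattice A :=
      fun w hw => (mem_relationLattice_addUnitRow.1 hw).1
    have hrank : d ≤ Module.finrank ℤ (relationLattice B) := by
      let f : relationLattice A →ₗ[ℤ] ℤ := (LinearMap.proj e).comp (relationLattice A).subtype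
      have h1 := finrank_range_add_finrank_ker_int f
      have h2 : Module.finrank ℤ (LinearMap.range f) ≤ 1 := by
        simpa using Submodule.finrank_le (LinearMap.range f)
      have h3 : relationLattice B = (LinearMap.ker f).map (relationLattice A).subtype := by
        ext w
        simp only [B, mem_relationLattice_addUnitRow, Submodule.mem_map, LinearMap.mem_ker]
        constructor
        · rintro ⟨hw, hwe⟩
          exact ⟨⟨w, hw⟩, hwe, rfl⟩
        · rintro ⟨w, hw, rfl⟩
          exact ⟨w.2, hw⟩
      rw [h3, (Submodule.equivMapOfInjective _ (relationLattice A).injective_subtype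
        (LinearMap.ker f)).symm.finrank_eq]
      omega
    have hlt : toricIdeal k B < toricIdeal k A := by
      refine lt_of_le_of_ne (toricIdeal_mono hle) fun h => he ?_
      obtain ⟨α, β, hαβ, -⟩ := exists_expDiff_eq u
      have h1 : (monomial α 1 - monomial β 1 : MvPolynomial n k) ∈ toricIdeal k A :=
        binomial_mem_toricIdeal.2 (mulVec_eq_iff.2 (hαβ ▸ hu))
      rw [← h, binomial_mem_toricIdeal, mulVec_eq_iff, hαβ] at h1
      exact (mem_relationLattice_addUnitRow.1 h1).2
    calc ((d + 1 : ℕ) : ℕ∞) ≤ (toricIdeal k B).height + 1 := by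
          push_cast
          gcongr
          exact ih B hrank
      _ ≤ _ := Ideal.height_add_one_le_of_lt_of_isPrime hlt

/-- The height of a toric ideal is the rank of its lattice. -/
theorem height_toricIdeal (A : Matrix m n ℕ) :
    (toricIdeal k A).height = Module.finrank ℤ (relationLattice A) :=
  le_antisymm (height_toricIdeal_le A) (le_height_toricIdeal_of_le_finrank _ A le_rfl)

end ToricTheory

/-! ### Graded Nakayama and minimal generators chosen among binomials. -/

section BinomialGenerators

open MvPolynomial

attribute [local instance] MvPolynomial.gradedAlgebra

variable {k : Type*} [Field k] {m n : Type*}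

/-- The ideal generated by the variables. -/
noncomputable def variableIdeal (k : Type*) [Field k] (n : Type*) : Ideal (MvPolynomial n k) :=
  Ideal.span (Set.range X)

theorem coeff_zero_of_mem_variableIdeal {f : MvPolynomial n k} (hf : f ∈ variableIdeal k n) :
    coeff 0 f = 0 := by
  have : variableIdeal k n ≤ RingHom.ker (constantCoeff (σ := n) (R := k)) := by
    rw [variableIdeal, Ideal.span_le]
    rintro _ ⟨i, rfl⟩
    simp
  exact this hf

theorem sub_C_mem_variableIdeal (f : MvPolynomial n k) :
    f - C (coeff 0 f) ∈ variableIdeal k n := by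
  have h2 := (f - C (coeff 0 f)).mem_ideal_span_X_image (s := Set.univ)
  rw [Set.image_univ] at h2
  refine h2.2 fun d hd => ?_
  have hd0 : d ≠ 0 := by
    rintro rfl
    simp at hd
  obtain ⟨i, hi⟩ := Finsupp.ne_iff.1 hd0
  exact ⟨i, trivial, hi⟩

theorem monomial_mem_variableIdeal {α : n →₀ ℕ} (h : α ≠ 0) :
    (monomial α 1 : MvPolynomial n k) ∈ variableIdeal k n := by
  classical
  have h2 := sub_C_mem_variableIdeal (monomial α 1 : MvPolynomial n k)
  rwa [coeff_monomial, if_neg h, map_zero, sub_zero] at h2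

variable [Fintype n]

/-- Nakayama's lemma for a homogeneous ideal and a set of homogeneous elements of it. -/
theorem le_span_of_le_sup_variableIdeal_mul {I : Ideal (MvPolynomial n k)}
    {T U : Set (MvPolynomial n k)} (hU : Ideal.span U = I)
    (hUh : ∀ f ∈ U, ∃ d, f.IsHomogeneous d) (hTh : ∀ f ∈ T, ∃ d, f.IsHomogeneous d)
    (h : I ≤ Ideal.span T ⊔ variableIdeal k n * I) : I ≤ Ideal.span T := by
  classical
  obtain ⟨r, hr, hrI⟩ := Submodule.exists_sub_one_mem_and_smul_le_of_fg_of_le_sup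
    (I := variableIdeal k n) (N := Ideal.span T) (N' := I) (P := I)
    (IsNoetherian.noetherian I) le_rfl h
  have hhom : (Ideal.span T).IsHomogeneous (homogeneousSubmodule n k) :=
    Ideal.homogeneous_span _ _ fun f hf => (hTh f hf).imp fun d hd => hd
  rw [← hU, Ideal.span_le]
  intro f hf
  obtain ⟨d, hd⟩ := hUh f hf
  have hmem : r * f ∈ Ideal.span T :=
    hrI (Submodule.smul_mem_pointwise_smul f r I (hU ▸ Ideal.subset_span hf))
  have h2 := homogeneousComponent_mem_of_mem hhom hmem d
  -- Nakayama supplies `r` with constant term 1 and `r * I ⊆ span T`. Since `f` is homogeneous of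
  -- degree `d`, the component of `r * f` in degree `d` is `f`, and it lies in the homogeneous ideal
  -- `span T`.
  have h3 : homogeneousComponent d (r * f) = f := by
    have hsplit : r * f = f + (r - 1) * f := by ring
    rw [hsplit, map_add, homogeneousComponent_of_mem hd, if_pos rfl, add_eq_left]
    ext γ
    rw [coeff_homogeneousComponent, coeff_zero]
    split_ifs with hγ
    · rw [coeff_mul]
      refine Finset.sum_eq_zero fun p hp => ?_
      rw [Finset.HasAntidiagonal.mem_antidiagonal] at hp
      by_cases h1 : p.1 = 0
      · rw [h1, coeff_zero_of_mem_variableIdeal hr, zero_mul]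
      · rw [hd.coeff_eq_zero, mul_zero]
        rw [← hp, map_add] at hγ
        have : p.1.degree ≠ 0 := by simpa [Finsupp.degree_eq_zero_iff] using h1
        omega
    · rfl
  rwa [h3] at h2

/-- With `𝔪` the ideal of the variables, every generating set of `I` spans `I/𝔪I` over `k`, so this
space has dimension at most `spanFinrank I`. A basis taken from the image of `U` lifts to generators
by Nakayama, and its members, being nonzero, come from outside `𝔪I`. -/
theorem exists_generators_of_homogeneous {I : Ideal (MvPolynomial n k)}
    {U : Set (MvPolynomial n k)} (hU : Ideal.span U = I)
    (hUh : ∀ f ∈ U, ∃ d, f.IsHomogeneous d) :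
    ∃ T : Set (MvPolynomial n k), T ⊆ U ∧ T.Finite ∧ T.ncard ≤ Submodule.spanFinrank I ∧
      Ideal.span T = I ∧ ∀ f ∈ T, f ∉ variableIdeal k n * I := by
  classical
  set J := variableIdeal k n * I with hJ
  let π : MvPolynomial n k →ₗ[k] MvPolynomial n k ⧸ J := (Ideal.Quotient.mkₐ k J).toLinearMap
  have hπ : ∀ f, π f = 0 ↔ f ∈ J := fun f => Ideal.Quotient.eq_zero_iff_mem
  obtain ⟨b, hbU, hbspan, hbind⟩ := exists_linearIndependent k (π '' U)
  -- the image of any generating set spans the image of the ideal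
  have hspan : ∀ W : Set (MvPolynomial n k), Ideal.span W = I →
      ∀ f ∈ I, π f ∈ Submodule.span k (π '' W) := by
    intro W hW f hf
    rw [← hW] at hf
    induction hf using Submodule.span_induction with
    | mem x hx => exact Submodule.subset_span ⟨x, hx, rfl⟩
    | zero => simp
    | add x y _ _ hx hy => rw [map_add]; exact add_mem hx hy
    | smul a x hx hx' =>
      -- On `I/𝔪I` a polynomial acts through its constant term.
      have : π (a • x) = coeff 0 a • π x := by
        rw [← map_smul, ← sub_eq_zero, ← map_sub, hπ, smul_eq_mul, smul_eq_C_mul, ← sub_mul]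
        exact Ideal.mul_mem_mul (sub_C_mem_variableIdeal a) (hW ▸ hx)
      rw [this]
      exact Submodule.smul_mem _ _ hx'
  obtain ⟨S, hScard, hS⟩ := (IsNoetherian.noetherian I).exists_span_finset_card_eq_spanFinrank
  have hsub : Submodule.span k b ≤ Submodule.span k (S.image π : Set (MvPolynomial n k ⧸ J)) := by
    rw [hbspan, Submodule.span_le]
    rintro _ ⟨f, hf, rfl⟩
    rw [Finset.coe_image]
    exact hspan S hS f (hU ▸ Ideal.subset_span hf)
  have hfin : b.Finite := by
    refine Set.finite_coe_iff.1 (hbind.finite_of_le_span_finite _ (S.image π : Set _) ?_)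
    rw [Subtype.range_coe]
    exact Submodule.span_le.1 hsub
  have hcard : b.ncard ≤ Submodule.spanFinrank I := by
    have : Fintype b := hfin.fintype
    rw [← Nat.card_coe_set_eq, Nat.card_eq_fintype_card, ← hScard]
    have h1 := finrank_span_eq_card hbind
    rw [Subtype.range_coe] at h1
    rw [← h1]
    exact (Submodule.finrank_mono hsub).trans ((finrank_span_finset_le_card _).trans
      Finset.card_image_le)
  replace hbU : ∀ x, x ∈ b → x ∈ π '' U := fun x hx => hbU hx
  choose! s hsU hsπ using hbU
  refine ⟨s '' b, ?_, hfin.image s, (Set.ncard_image_le hfin).trans hcard, ?_, ?_⟩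
  · rintro _ ⟨x, hx, rfl⟩
    exact hsU x hx
  · have hsubU : s '' b ⊆ U := by
      rintro _ ⟨x, hx, rfl⟩
      exact hsU x hx
    refine le_antisymm (hU ▸ Ideal.span_mono hsubU) ?_
    refine le_span_of_le_sup_variableIdeal_mul hU hUh (fun f hf => hUh f (hsubU hf)) ?_
    intro f hf
    have h1 := hspan U hU f hf
    rw [← hbspan] at h1
    have h2 : π '' (s '' b) = b := by
      rw [Set.image_image]
      exact (Set.image_congr fun x hx => hsπ x hx).trans (Set.image_id b)
    rw [← h2, Submodule.span_image] at h1
    obtain ⟨g, hg, hgf⟩ := h1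
    rw [← sub_add_cancel f g, add_comm]
    refine Submodule.add_mem_sup ?_ ?_
    · exact Submodule.span_le_restrictScalars k (MvPolynomial n k) _ hg
    · rw [← hJ, ← hπ, map_sub, hgf, sub_self]
  · rintro _ ⟨x, hx, rfl⟩ hmem
    rw [← hπ, hsπ x hx] at hmem
    exact hbind.ne_zero ⟨x, hx⟩ hmem

variable [Fintype m]

/-- If the columns of `A` have a common sum, then the toric ideal has a set of minimal generators
consisting of binomials. -/
theorem exists_binomial_generators (A : Matrix m n ℕ)
    (hA : ∀ α β : n →₀ ℕ, A.mulVec α = A.mulVec β → α.degree = β.degree) :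
    ∃ (s : ℕ) (α β : Fin s → n →₀ ℕ), s ≤ Submodule.spanFinrank (toricIdeal k A) ∧
      (∀ i, A.mulVec (α i) = A.mulVec (β i)) ∧
      (∀ i, (monomial (α i) 1 - monomial (β i) 1 : MvPolynomial n k) ∉
        variableIdeal k n * toricIdeal k A) ∧
      Ideal.span (Set.range fun i => (monomial (α i) 1 - monomial (β i) 1 : MvPolynomial n k)) =
        toricIdeal k A := by
  obtain ⟨T, hTU, hTfin, hTcard, hTspan, hT⟩ :=
    exists_generators_of_homogeneous (toricIdeal_eq_span (k := k) A).symm (by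
      rintro _ ⟨α, β, h, rfl⟩
      exact ⟨α.degree,
        (isHomogeneous_monomial 1 rfl).sub (isHomogeneous_monomial 1 (hA α β h).symm)⟩)
  have e := (hTfin.equivFin).symm
  rw [Nat.card_coe_set_eq] at e
  have : ∀ i, ∃ α β : n →₀ ℕ, A.mulVec α = A.mulVec β ∧
      (e i : MvPolynomial n k) = monomial α 1 - monomial β 1 := fun i => hTU (e i).2
  choose α β h1 h2 using this
  refine ⟨T.ncard, α, β, hTcard, h1, fun i => h2 i ▸ hT _ (e i).2, ?_⟩
  simp_rw [← h2]
  rw [show (fun i => (e i : MvPolynomial n k)) = Subtype.val ∘ e from rfl, e.surjective.range_comp,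
    Subtype.range_coe, hTspan]

end BinomialGenerators

/-! ### Generators that avoid a set of variables. -/

section Faces

open MvPolynomial

variable {k : Type*} [Field k] {m n ι : Type*} [Fintype m] [Fintype n]

/-- The binomials among a set of generators of a toric ideal that avoid the variables of `Z`
generate the sublattice of vectors vanishing on `Z`, provided that each of the generators has either
both or none of its monomials divisible by a variable of `Z`. -/
theorem mem_span_expDiff_of_vanishing {A : Matrix m n ℕ} {α β : ι → n →₀ ℕ}
    (hspan : Ideal.span (Set.range fun i =>
      (monomial (α i) 1 - monomial (β i) 1 : MvPolynomial n k)) = toricIdeal k A)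
    (Z : Set n) (hZ : ∀ i, (∃ j ∈ Z, α i j ≠ 0) ↔ ∃ j ∈ Z, β i j ≠ 0)
    {u : n → ℤ} (hu : u ∈ relationLattice A) (huZ : ∀ j ∈ Z, u j = 0) :
    u ∈ Submodule.span ℤ ((fun i => expDiff (α i) (β i)) '' {i | ∀ j ∈ Z, α i j = 0}) := by
  classical
  set N := Submodule.span ℤ ((fun i => expDiff (α i) (β i)) '' {i | ∀ j ∈ Z, α i j = 0})
  -- `Φ` kills the variables in `Z` and sends every other one to its class in the group algebra of
  -- `ℤⁿ/N`. Each generator dies, either because both monomials meet `Z` or because their difference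
  -- lies in `N`.
  let Φ : MvPolynomial n k →ₐ[k] AddMonoidAlgebra k ((n → ℤ) ⧸ N) :=
    aeval fun j => if j ∈ Z then 0 else AddMonoidAlgebra.single (N.mkQ (Pi.single j 1)) 1
  have hΦ0 : ∀ γ : n →₀ ℕ, (∃ j ∈ Z, γ j ≠ 0) → Φ (monomial γ 1) = 0 := by
    rintro γ ⟨j, hj, hγ⟩
    simp only [Φ]
    rw [MvPolynomial.aeval_monomial, Finsupp.prod]
    rw [Finset.prod_eq_zero (Finsupp.mem_support_iff.2 hγ), mul_zero]
    rw [if_pos hj, zero_pow hγ]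
  have hΦ1 : ∀ γ : n →₀ ℕ, (∀ j ∈ Z, γ j = 0) →
      Φ (monomial γ 1) = AddMonoidAlgebra.single (N.mkQ fun j => (γ j : ℤ)) 1 := by
    intro γ hγ
    simp only [Φ]
    rw [MvPolynomial.aeval_monomial, map_one, one_mul, Finsupp.prod_fintype _ _ (by simp)]
    have h1 : ∀ j, (if j ∈ Z then (0 : AddMonoidAlgebra k ((n → ℤ) ⧸ N)) else
        AddMonoidAlgebra.single (N.mkQ (Pi.single j 1)) 1) ^ γ j =
        AddMonoidAlgebra.of k _ (Multiplicative.ofAdd (N.mkQ (Pi.single j (γ j : ℤ)))) := by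
      intro j
      by_cases hj : j ∈ Z
      · rw [hγ j hj]
        simp [AddMonoidAlgebra.one_def]
      · rw [if_neg hj, AddMonoidAlgebra.single_pow, one_pow, AddMonoidAlgebra.of_apply,
          toAdd_ofAdd, ← map_nsmul]
        congr 2
        ext l
        by_cases h : l = j
        · subst h; simp
        · simp [h]
    simp_rw [h1]
    rw [← map_prod, ← ofAdd_sum, ← map_sum, AddMonoidAlgebra.of_apply, toAdd_ofAdd]
    congr 2
    exact Finset.univ_sum_single _
  have hker : toricIdeal k A ≤ RingHom.ker Φ := by
    rw [← hspan, Ideal.span_le]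
    rintro _ ⟨i, rfl⟩
    rw [SetLike.mem_coe, RingHom.mem_ker, map_sub, sub_eq_zero]
    by_cases h : ∃ j ∈ Z, α i j ≠ 0
    · rw [hΦ0 _ h, hΦ0 _ ((hZ i).1 h)]
    · have h' := mt (hZ i).2 h
      push Not at h h'
      rw [hΦ1 _ h, hΦ1 _ h']
      congr 1
      rw [← sub_eq_zero, ← map_sub]
      exact (Submodule.Quotient.mk_eq_zero N).2 (Submodule.subset_span ⟨i, h, rfl⟩)
  -- Both parts of `u` avoid `Z`, so `Φ` sees their full classes, and these must agree modulo `N`.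
  obtain ⟨γ, δ, hγδ, h0⟩ := exists_expDiff_eq u
  have hmem : (monomial γ 1 - monomial δ 1 : MvPolynomial n k) ∈ toricIdeal k A :=
    binomial_mem_toricIdeal.2 (mulVec_eq_iff.2 (hγδ ▸ hu))
  have h2 := hker hmem
  rw [RingHom.mem_ker, map_sub, sub_eq_zero, hΦ1 _ fun j hj => (h0 j (huZ j hj)).1,
    hΦ1 _ fun j hj => (h0 j (huZ j hj)).2] at h2
  have h3 := (AddMonoidAlgebra.single_left_inj (one_ne_zero (α := k))).1 h2
  rw [← sub_eq_zero, ← map_sub] at h3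
  rw [← hγδ]
  exact (Submodule.Quotient.mk_eq_zero N).1 h3

end Faces

/-! ### The relation lattice of a graph and its rank. -/

section Incidence

variable {V : Type*} {G : SimpleGraph V}

open Classical in
theorem incidence_apply (v : V) (e : G.edgeSet) :
    incidence G v e = if v ∈ (e : Sym2 V) then 1 else 0 := by
  simp only [incidence, Matrix.submatrix_apply, id_eq]
  rw [SimpleGraph.incMatrix_apply']
  exact if_congr ⟨fun h => h.2, fun h => ⟨e.2, h⟩⟩ rfl rfl

/-- The extension by zero to all pairs of vertices of a function on the edges. -/
noncomputable def edgeExtend (u : G.edgeSet → ℤ) (s : Sym2 V) : ℤ :=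
  open Classical in if h : s ∈ G.edgeSet then u ⟨s, h⟩ else 0

theorem edgeExtend_of_mem (u : G.edgeSet → ℤ) {s : Sym2 V} (h : s ∈ G.edgeSet) :
    edgeExtend u s = u ⟨s, h⟩ := dif_pos h

theorem edgeExtend_of_notMem (u : G.edgeSet → ℤ) {s : Sym2 V} (h : s ∉ G.edgeSet) :
    edgeExtend u s = 0 := dif_neg h

theorem mem_edgeSet_of_edgeExtend_ne_zero {u : G.edgeSet → ℤ} {s : Sym2 V}
    (h : edgeExtend u s ≠ 0) : s ∈ G.edgeSet := by
  by_contra h'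
  exact h (edgeExtend_of_notMem u h')

variable [Fintype G.edgeSet]

theorem mulVec_incidence_ne_zero_iff {α : G.edgeSet →₀ ℕ} {v : V} :
    (incidence G).mulVec α v ≠ 0 ↔ ∃ e : G.edgeSet, v ∈ (e : Sym2 V) ∧ α e ≠ 0 := by
  classical
  simp [Matrix.mulVec, dotProduct, incidence_apply]

variable [Fintype V]

theorem sum_incidence_mul (v : V) (u : G.edgeSet → ℤ) :
    ∑ e, (incidence G v e : ℤ) * u e = ∑ w, edgeExtend u s(v, w) := by
  classical
  have h1 : ∀ w, edgeExtend u s(v, w) =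
      ∑ e : G.edgeSet, if (e : Sym2 V) = s(v, w) then u e else 0 := by
    intro w
    by_cases h : s(v, w) ∈ G.edgeSet
    · rw [edgeExtend_of_mem u h, Finset.sum_eq_single ⟨s(v, w), h⟩]
      · simp
      · intro e _ he
        rw [if_neg fun h' => he (Subtype.ext h')]
      · simp
    · rw [edgeExtend_of_notMem u h, Finset.sum_eq_zero]
      intro e _
      exact if_neg fun h' : (e : Sym2 V) = s(v, w) => h (h' ▸ e.2)
  simp_rw [h1]
  rw [Finset.sum_comm]
  refine Finset.sum_congr rfl fun e _ => ?_
  rw [incidence_apply]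
  split_ifs with hv
  · obtain ⟨x, hx⟩ := Sym2.mem_iff_exists.1 hv
    rw [Finset.sum_eq_single x]
    · simp [hx]
    · intro w _ hw
      rw [if_neg]
      rw [hx]
      intro h
      exact hw (Sym2.congr_right.1 h).symm
    · simp
  · rw [Finset.sum_eq_zero]
    · simp
    · intro w _
      rw [if_neg]
      intro h
      exact hv (h ▸ Sym2.mem_mk_left v w)

theorem mem_relationLattice_incidence {u : G.edgeSet → ℤ} :
    u ∈ relationLattice (incidence G) ↔ ∀ v, ∑ w, edgeExtend u s(v, w) = 0 := by
  simp_rw [mem_relationLattice, sum_incidence_mul]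

/-- Each column of the incidence matrix has sum 2. This makes toric binomials homogeneous. -/
theorem degree_eq_of_mulVec_incidence_eq {α β : G.edgeSet →₀ ℕ}
    (h : (incidence G).mulVec α = (incidence G).mulVec β) : α.degree = β.degree := by
  classical
  have key : ∀ γ : G.edgeSet →₀ ℕ, ∑ v, (incidence G).mulVec γ v = 2 * γ.degree := by
    intro γ
    simp only [Matrix.mulVec, dotProduct]
    rw [Finset.sum_comm, Finsupp.degree_eq_sum, Finset.mul_sum]
    refine Finset.sum_congr rfl fun e _ => ?_
    rw [← Finset.sum_mul]
    congr 1
    exact G.sum_incMatrix_apply_of_mem_edgeSet e.2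
  have := key α
  rw [h, key β] at this
  omega

theorem three_mul_card_eq [DecidableRel G.Adj] (hG : G.IsRegularOfDegree 3) :
    3 * Fintype.card V = 2 * Fintype.card G.edgeSet := by
  classical
  have h := G.sum_degrees_eq_twice_card_edges
  simp only [hG.degree_eq, Finset.sum_const, Finset.card_univ, smul_eq_mul] at h
  rw [mul_comm, h, ← Set.toFinset_card]
  congr!

theorem card_edgeSet_le_finrank_add :
    Fintype.card G.edgeSet ≤ Module.finrank ℤ (relationLattice (incidence G)) +
      Fintype.card V := by
  have h1 := finrank_range_add_finrank_ker_int ((incidence G).map (Nat.cast : ℕ → ℤ)).mulVecLin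
  have h2 := Submodule.finrank_le
    (LinearMap.range ((incidence G).map (Nat.cast : ℕ → ℤ)).mulVecLin)
  rw [Module.finrank_fintype_fun_eq_card] at h1 h2
  have h3 : Module.finrank ℤ (relationLattice (incidence G)) = Module.finrank ℤ
    (LinearMap.ker ((incidence G).map (Nat.cast : ℕ → ℤ)).mulVecLin) := rfl
  omega

/-- If the rank of the lattice is as small as possible, then no component of `G` is bipartite. -/
theorem eq_zero_of_forall_adj_add_eq_zero
    (h : Module.finrank ℤ (relationLattice (incidence G)) + Fintype.card V ≤
      Fintype.card G.edgeSet)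
    {y : V → ℤ} (hy : ∀ v w, G.Adj v w → y v + y w = 0) : y = 0 := by
  classical
  by_contra hy0
  obtain ⟨v, hv⟩ := Function.ne_iff.1 hy0
  set f := ((incidence G).map (Nat.cast : ℕ → ℤ)).mulVecLin with hf
  have h1 := finrank_range_add_finrank_ker_int f
  -- Pairing with `y` kills every column of the incidence matrix. If `y ≠ 0`, its range has rank at
  -- most `|V| - 1`, and the lattice is larger than assumed.
  let g : (V → ℤ) →ₗ[ℤ] ℤ := ∑ v, y v • LinearMap.proj v
  have hg : ∀ x, g x = ∑ v, y v * x v := by intro x; simp [g]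
  have h2 := finrank_range_add_finrank_ker_int g
  have h3 : LinearMap.range f ≤ LinearMap.ker g := by
    rintro _ ⟨x, rfl⟩
    rw [LinearMap.mem_ker, hg]
    simp only [hf, Matrix.mulVecLin_apply, Matrix.mulVec, dotProduct, Matrix.map_apply,
      Finset.mul_sum]
    rw [Finset.sum_comm]
    refine Finset.sum_eq_zero fun e _ => ?_
    obtain ⟨e, he⟩ := e
    induction e using Sym2.ind with
    | _ a b =>
      have hab : a ≠ b := G.ne_of_adj he
      have : ∀ v, y v * ((incidence G v ⟨s(a, b), he⟩ : ℤ) * x ⟨s(a, b), he⟩) =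
          (if v = a then y v * x ⟨s(a, b), he⟩ else 0) +
          (if v = b then y v * x ⟨s(a, b), he⟩ else 0) := by
        intro v
        rw [incidence_apply]
        by_cases h1 : v = a
        · have : v ≠ b := fun h => hab (h1 ▸ h)
          simp [h1, hab]
        · by_cases h2 : v = b <;> simp [h1, h2, hab.symm]
      simp_rw [this]
      rw [Finset.sum_add_distrib]
      simp [← add_mul, hy a b he]
  have h4 := Submodule.finrank_mono h3
  have h5 : 0 < Module.finrank ℤ (LinearMap.range g) := by
    rw [Module.finrank_pos_iff]
    refine Submodule.nontrivial_iff_ne_bot.2 fun hbot => ?_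
    have : g (Pi.single v 1) = 0 := by
      have : g (Pi.single v 1) ∈ LinearMap.range g := ⟨_, rfl⟩
      rwa [hbot, Submodule.mem_bot] at this
    rw [hg] at this
    simp [Pi.single_apply] at this
    exact hv this
  rw [Module.finrank_fintype_fun_eq_card] at h1 h2
  have h6 : Module.finrank ℤ (relationLattice (incidence G)) =
    Module.finrank ℤ (LinearMap.ker f) := rfl
  omega

end Incidence

/-! ### Minimality of a binomial generator. -/

section MinimalBinomials

open MvPolynomial

variable {k : Type*} [Field k] {m n : Type*} [Fintype m] [Fintype n]

/-- The identity `x^α - x^β = x^(α-γ) (x^γ - x^δ) + x^δ (x^(α-γ) - x^(β-δ))` writes the binomial as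
a member of `𝔪P` unless `α = γ`; equality of degrees then gives `β = δ`. -/
theorem eq_of_le_of_binomial_notMem {A : Matrix m n ℕ}
    (hA : ∀ α β : n →₀ ℕ, A.mulVec α = A.mulVec β → α.degree = β.degree)
    {α β γ δ : n →₀ ℕ} (hαβ : A.mulVec α = A.mulVec β) (hγδ : A.mulVec γ = A.mulVec δ)
    (hγ : γ ≤ α) (hδ : δ ≤ β) (hδ0 : δ ≠ 0)
    (hmin : (monomial α 1 - monomial β 1 : MvPolynomial n k) ∉
      variableIdeal k n * toricIdeal k A) : α = γ ∧ β = δ := by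
  obtain ⟨α, rfl⟩ := exists_add_of_le hγ
  obtain ⟨β, rfl⟩ := exists_add_of_le hδ
  have hαβ' : A.mulVec α = A.mulVec β := by
    rw [mulVec_eq_iff] at hαβ hγδ ⊢
    convert sub_mem hαβ hγδ using 1
    ext j; simp [expDiff]; ring
  have hα : α = 0 := by
    by_contra hα0
    refine hmin ?_
    have : (monomial (γ + α) 1 - monomial (δ + β) 1 : MvPolynomial n k) =
        monomial α 1 * (monomial γ 1 - monomial δ 1) +
        monomial δ 1 * (monomial α 1 - monomial β 1) := by
      simp only [mul_sub, monomial_mul, mul_one, add_comm α]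
      ring
    rw [this]
    exact add_mem
      (Ideal.mul_mem_mul (monomial_mem_variableIdeal hα0) (binomial_mem_toricIdeal.2 hγδ))
      (Ideal.mul_mem_mul (monomial_mem_variableIdeal hδ0) (binomial_mem_toricIdeal.2 hαβ'))
  have hβ : β = 0 := by
    have := hA α β hαβ'
    rw [hα, map_zero] at this
    exact (Finsupp.degree_eq_zero_iff β).1 this.symm
  rw [hα, hβ, add_zero, add_zero]
  exact ⟨rfl, rfl⟩

end MinimalBinomials

/-! ### The vertices met by a minimal binomial. -/

section FourCycles

open MvPolynomial

variable {k : Type*} [Field k] {V : Type*} {G : SimpleGraph V} [Fintype G.edgeSet]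

theorem mulVec_single_incidence (e : G.edgeSet) (v : V) :
    (incidence G).mulVec (Finsupp.single e 1 : G.edgeSet →₀ ℕ) v = incidence G v e := by
  classical
  simp [Matrix.mulVec, dotProduct, Finsupp.single_apply]

theorem mulVec_matching_eq {a b c d : V} (hab : G.Adj a b) (hcd : G.Adj c d) (hac : G.Adj a c)
    (hbd : G.Adj b d) :
    (incidence G).mulVec ((Finsupp.single ⟨s(a, b), hab⟩ 1 + Finsupp.single ⟨s(c, d), hcd⟩ 1 :
        G.edgeSet →₀ ℕ)) =
      (incidence G).mulVec ((Finsupp.single ⟨s(a, c), hac⟩ 1 + Finsupp.single ⟨s(b, d), hbd⟩ 1 :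
        G.edgeSet →₀ ℕ)) := by
  classical
  have := hab.ne; have := hcd.ne; have := hac.ne; have := hbd.ne
  ext v
  rw [Finsupp.coe_add, Finsupp.coe_add, Matrix.mulVec_add, Matrix.mulVec_add]
  simp only [Pi.add_apply, mulVec_single_incidence, incidence_apply, Sym2.mem_iff]
  by_cases h1 : v = a <;> by_cases h2 : v = b <;> by_cases h3 : v = c <;> by_cases h4 : v = d <;>
    simp_all

variable [Fintype V]

/-- A minimal binomial generator involves at least four vertices; if there are just four of them,
then it is the quadric of a 4-cycle. -/
theorem four_le_card_and_exists_cycle {α β : G.edgeSet →₀ ℕ}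
    (hαβ : (incidence G).mulVec α = (incidence G).mulVec β)
    (hmin : (monomial α 1 - monomial β 1 : MvPolynomial G.edgeSet k) ∉
      variableIdeal k G.edgeSet * toricIdeal k (incidence G))
    {W : Finset V} (hW : ∀ v, v ∈ W ↔ (incidence G).mulVec α v ≠ 0) :
    4 ≤ W.card ∧ (W.card = 4 → ∃ (a b c d : V) (hab : G.Adj a b) (hbc : G.Adj b c)
      (hcd : G.Adj c d) (had : G.Adj a d), a ≠ c ∧ b ≠ d ∧
        (∀ x, x ∈ W ↔ x = a ∨ x = b ∨ x = c ∨ x = d) ∧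
        α = Finsupp.single ⟨s(a, b), hab⟩ 1 + Finsupp.single ⟨s(c, d), hcd⟩ 1 ∧
        β = Finsupp.single ⟨s(a, d), had⟩ 1 + Finsupp.single ⟨s(b, c), hbc⟩ 1) := by
  classical
  have hA := fun α β : G.edgeSet →₀ ℕ => degree_eq_of_mulVec_incidence_eq (α := α) (β := β)
  have hne : α ≠ β := by
    rintro rfl
    simp at hmin
  have hα0 : α ≠ 0 := by
    rintro rfl
    have := hA _ _ hαβ
    rw [map_zero] at this
    exact hne ((Finsupp.degree_eq_zero_iff β).1 this.symm).symm
  -- A variable common to both monomials could be split off, taking `γ = δ` to be that variable.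
  have hdisj : ∀ e, α e ≠ 0 → β e = 0 := by
    intro e he
    by_contra he'
    have h1 : Finsupp.single e 1 ≤ α := by
      rw [Finsupp.single_le_iff]; omega
    have h2 : Finsupp.single e 1 ≤ β := by
      rw [Finsupp.single_le_iff]; omega
    obtain ⟨h3, h4⟩ := eq_of_le_of_binomial_notMem hA hαβ rfl h1 h2 (by simp) hmin
    exact hne (h3.trans h4.symm)
  have hWβ : ∀ v, v ∈ W ↔ (incidence G).mulVec β v ≠ 0 := fun v => by rw [hW, hαβ]
  -- an edge at `v` in the other monomial
  have hexα : ∀ v ∈ W, ∃ (w : V) (h : G.Adj v w), α ⟨s(v, w), h⟩ ≠ 0 ∧ w ∈ W := by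
    intro v hv
    obtain ⟨⟨e, he⟩, h1, h2⟩ := mulVec_incidence_ne_zero_iff.1 ((hW v).1 hv)
    obtain ⟨w, rfl⟩ := Sym2.mem_iff_exists.1 h1
    exact ⟨w, he, h2, (hW w).2 (mulVec_incidence_ne_zero_iff.2 ⟨_, Sym2.mem_mk_right v w, h2⟩)⟩
  have hexβ : ∀ v ∈ W, ∃ (w : V) (h : G.Adj v w), β ⟨s(v, w), h⟩ ≠ 0 ∧ w ∈ W := by
    intro v hv
    obtain ⟨⟨e, he⟩, h1, h2⟩ := mulVec_incidence_ne_zero_iff.1 ((hWβ v).1 hv)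
    obtain ⟨w, rfl⟩ := Sym2.mem_iff_exists.1 h1
    exact ⟨w, he, h2, (hWβ w).2 (mulVec_incidence_ne_zero_iff.2 ⟨_, Sym2.mem_mk_right v w, h2⟩)⟩
  have hcontra : ∀ {v w v' w' : V} (h : G.Adj v w) (h' : G.Adj v' w'), s(v, w) = s(v', w') →
      α ⟨s(v, w), h⟩ ≠ 0 → β ⟨s(v', w'), h'⟩ ≠ 0 → False := by
    intro v w v' w' h h' heq h1 h2
    have : (⟨s(v', w'), h'⟩ : G.edgeSet) = ⟨s(v, w), h⟩ := Subtype.ext heq.symm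
    rw [this] at h2
    exact h2 (hdisj _ h1)
  obtain ⟨v, w, hvw, hαvw, hvW, hwW⟩ : ∃ (v w : V) (h : G.Adj v w), α ⟨s(v, w), h⟩ ≠ 0 ∧
      v ∈ W ∧ w ∈ W := by
    obtain ⟨⟨e, he⟩, h2⟩ := Finsupp.ne_iff.1 hα0
    induction e using Sym2.ind with
    | _ v w =>
      exact ⟨v, w, he, h2, (hW v).2 (mulVec_incidence_ne_zero_iff.2 ⟨_, Sym2.mem_mk_left v w, h2⟩),
        (hW w).2 (mulVec_incidence_ne_zero_iff.2 ⟨_, Sym2.mem_mk_right v w, h2⟩)⟩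
  -- Starting from an `α`-edge `vw`, `β`-edges at `v` and `w` lead to `z` and `y`. If these
  -- coincide, the `α`-edge at that vertex leads to a fourth one.
  obtain ⟨p, q, hpW, hqW, hpq, hvp, hvq, hwp, hwq⟩ : ∃ p q : V, p ∈ W ∧ q ∈ W ∧ p ≠ q ∧ v ≠ p ∧
      v ≠ q ∧ w ≠ p ∧ w ≠ q := by
    obtain ⟨z, hvz, hβvz, hzW⟩ := hexβ v hvW
    obtain ⟨y, hwy, hβwy, hyW⟩ := hexβ w hwW
    have hwz : w ≠ z := by
      rintro rfl
      exact hcontra hvw hvz rfl hαvw hβvz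
    have hvy : v ≠ y := by
      rintro rfl
      exact hcontra hvw hwy Sym2.eq_swap hαvw hβwy
    by_cases hzy : z = y
    · subst hzy
      obtain ⟨q, hzq, hαzq, hqW⟩ := hexα z hzW
      refine ⟨z, q, hzW, hqW, hzq.ne, hvz.ne, ?_, hwz, ?_⟩
      · rintro rfl
        exact hcontra hzq hvz Sym2.eq_swap hαzq hβvz
      · rintro rfl
        exact hcontra hzq hwy Sym2.eq_swap hαzq hβwy
    · exact ⟨z, y, hzW, hyW, hzy, hvz.ne, hvy, hwz, hwy.ne⟩
  have hcard4 : ({v, w, p, q} : Finset V).card = 4 := by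
    rw [Finset.card_insert_of_notMem (by simp [hvw.ne, hvp, hvq]),
      Finset.card_insert_of_notMem (by simp [hwp, hwq]), Finset.card_pair hpq]
  have hsub : ({v, w, p, q} : Finset V) ⊆ W := by
    intro x hx
    simp only [Finset.mem_insert, Finset.mem_singleton] at hx
    rcases hx with rfl | rfl | rfl | rfl <;> assumption
  refine ⟨hcard4 ▸ Finset.card_le_card hsub, fun hcard => ?_⟩
  have hWeq : W = {v, w, p, q} := (Finset.eq_of_subset_of_card_le hsub (by omega)).symm
  set u := expDiff α β with hu
  have hmemW : ∀ x y, edgeExtend u s(x, y) ≠ 0 → y ∈ W := by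
    intro x y h
    have hxy := mem_edgeSet_of_edgeExtend_ne_zero h
    rw [edgeExtend_of_mem u hxy] at h
    by_cases h1 : α ⟨s(x, y), hxy⟩ = 0
    · have h2 : β ⟨s(x, y), hxy⟩ ≠ 0 := by
        intro h2
        simp [hu, expDiff, h1, h2] at h
      exact (hWβ y).2 (mulVec_incidence_ne_zero_iff.2 ⟨_, Sym2.mem_mk_right x y, h2⟩)
    · exact (hW y).2 (mulVec_incidence_ne_zero_iff.2 ⟨_, Sym2.mem_mk_right x y, h1⟩)
  have hsum : ∀ x, edgeExtend u s(x, v) + (edgeExtend u s(x, w) + (edgeExtend u s(x, p) +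
      edgeExtend u s(x, q))) = 0 := by
    intro x
    have h1 := mem_relationLattice_incidence.1 (mulVec_eq_iff.1 hαβ) x
    rw [← Finset.sum_subset (Finset.subset_univ W), hWeq, Finset.sum_insert (by
      simp [hvw.ne, hvp, hvq]), Finset.sum_insert (by simp [hwp, hwq]), Finset.sum_pair hpq] at h1
    · exact h1
    · intro y _ hy
      by_contra h
      exact hy (hmemW x y h)
  have hdiag : ∀ x, edgeExtend u s(x, x) = 0 := fun x =>
    edgeExtend_of_notMem u fun h => G.loopless.irrefl x h
  have s1 := hsum v
  have s2 := hsum w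
  have s3 := hsum p
  have s4 := hsum q
  rw [hdiag] at s1 s2 s3 s4
  rw [Sym2.eq_swap (a := w) (b := v)] at s2
  rw [Sym2.eq_swap (a := p) (b := v), Sym2.eq_swap (a := p) (b := w)] at s3
  rw [Sym2.eq_swap (a := q) (b := v), Sym2.eq_swap (a := q) (b := w),
    Sym2.eq_swap (a := q) (b := p)] at s4
  -- On four vertices the four vanishing sums give opposite edges equal values, and the three values
  -- of the pairs add up to zero. As the pair `vw`, `pq` is positive, one of the other two pairs is
  -- negative.
  have hpos : 0 < edgeExtend u s(v, w) := by
    rw [edgeExtend_of_mem u hvw]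
    have := hdisj _ hαvw
    simp only [hu, expDiff]
    omega
  have hlepos : ∀ {x y : V} (_ : 0 < edgeExtend u s(x, y)), ∃ h : G.Adj x y,
      1 ≤ α ⟨s(x, y), h⟩ := by
    intro x y h
    have hxy : G.Adj x y := mem_edgeSet_of_edgeExtend_ne_zero h.ne'
    refine ⟨hxy, ?_⟩
    rw [edgeExtend_of_mem u hxy] at h
    simp only [hu, expDiff] at h
    omega
  have hleneg : ∀ {x y : V} (_ : edgeExtend u s(x, y) < 0), ∃ h : G.Adj x y,
      1 ≤ β ⟨s(x, y), h⟩ := by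
    intro x y h
    have hxy : G.Adj x y := mem_edgeSet_of_edgeExtend_ne_zero h.ne
    refine ⟨hxy, ?_⟩
    rw [edgeExtend_of_mem u hxy] at h
    simp only [hu, expDiff] at h
    omega
  have hpair : ∀ (γ : G.edgeSet →₀ ℕ) (e f : G.edgeSet), e ≠ f → 1 ≤ γ e → 1 ≤ γ f →
      Finsupp.single e 1 + Finsupp.single f 1 ≤ γ := by
    intro γ e f hef h1 h2 x
    simp only [Finsupp.coe_add, Pi.add_apply, Finsupp.single_apply]
    by_cases h3 : e = x <;> by_cases h4 : f = x
    · exact absurd (h3.trans h4.symm) hef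
    · subst h3; simpa [h4] using h1
    · subst h4; simpa [h3] using h2
    · simp [h3, h4]
  have hfinish : ∀ p q : V, p ≠ q → v ≠ p → v ≠ q → w ≠ p → w ≠ q → W = {v, w, p, q} →
      0 < edgeExtend u s(p, q) → edgeExtend u s(v, p) < 0 → edgeExtend u s(w, q) < 0 →
      ∃ (a b c d : V) (hab : G.Adj a b) (hbc : G.Adj b c)
      (hcd : G.Adj c d) (had : G.Adj a d), a ≠ c ∧ b ≠ d ∧
        (∀ x, x ∈ W ↔ x = a ∨ x = b ∨ x = c ∨ x = d) ∧
        α = Finsupp.single ⟨s(a, b), hab⟩ 1 + Finsupp.single ⟨s(c, d), hcd⟩ 1 ∧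
        β = Finsupp.single ⟨s(a, d), had⟩ 1 + Finsupp.single ⟨s(b, c), hbc⟩ 1 := by
    intro p q hpq hvp hvq hwp hwq hWeq h1 h2 h3
    rw [Sym2.eq_swap] at h1
    obtain ⟨hqp, g1⟩ := hlepos h1
    obtain ⟨hvp', g2⟩ := hleneg h2
    obtain ⟨hwq', g3⟩ := hleneg h3
    obtain ⟨hvw', g4⟩ := hlepos hpos
    have e1 := hpair α ⟨s(v, w), hvw⟩ ⟨s(q, p), hqp⟩ (fun h => by
      rcases Sym2.eq_iff.1 (congrArg Subtype.val h) with h | h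
      exacts [hvq h.1, hvp h.1]) g4 g1
    have e2 := hpair β ⟨s(v, p), hvp'⟩ ⟨s(w, q), hwq'⟩ (fun h => by
      rcases Sym2.eq_iff.1 (congrArg Subtype.val h) with h | h
      exacts [hvw.ne h.1, hvq h.1]) g2 g3
    have e3 := mulVec_matching_eq hvw hqp.symm hvp' hwq'
    have e4 : (⟨s(p, q), hqp.symm⟩ : G.edgeSet) = ⟨s(q, p), hqp⟩ := Subtype.ext Sym2.eq_swap
    rw [e4] at e3
    -- The terms of the 4-cycle quadric divide those of the minimal binomial, so the two binomials
    -- coincide.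
    obtain ⟨e5, e6⟩ := eq_of_le_of_binomial_notMem hA hαβ e3 e1 e2 (by simp) hmin
    refine ⟨v, w, q, p, hvw, hwq', hqp, hvp', hvq, hwp, fun x => ?_, e5, e6⟩
    rw [hWeq, Finset.pair_comm p q]
    simp only [Finset.mem_insert, Finset.mem_singleton]
  have hpq' : 0 < edgeExtend u s(p, q) := by linarith
  rcases lt_or_ge (edgeExtend u s(v, p)) 0 with h | h
  · exact hfinish p q hpq hvp hvq hwp hwq hWeq hpq' h (by linarith)
  · refine hfinish q p hpq.symm hvq hvp hwq hwp ?_ ?_ (by linarith) (by linarith)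
    · rw [hWeq, Finset.pair_comm p q]
    · rwa [Sym2.eq_swap]

end FourCycles

/-! ### Incidence of vertices and edges with a 4-cycle. -/

section CyclePredicates

variable {V : Type*}

/-- `v` is a vertex of the 4-cycle `a b c d`. -/
def OnCycle (a b c d v : V) : Prop := v = a ∨ v = b ∨ v = c ∨ v = d

/-- `e` is an edge of the 4-cycle `a b c d`. -/
def IsCycleEdge (a b c d : V) (e : Sym2 V) : Prop :=
  e = s(a, b) ∨ e = s(b, c) ∨ e = s(c, d) ∨ e = s(a, d)

end CyclePredicates

/-! ### Double counting of vertices and generators. -/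

section Counting

open MvPolynomial

variable {k : Type*} [Field k] {V : Type*} [Fintype V] {G : SimpleGraph V}

/-- Two vectors of `ℤ²` on the same coordinate axis are dependent. This excludes an edge at a vertex
that both generators there miss. -/
theorem false_of_linearIndependent_of_eq_zero {ι : Type*} {f g : ι → ℤ}
    (h : LinearIndependent ℤ fun i => ![f i, g i]) {i j : ι} (hij : i ≠ j) (hi : f i = 0)
    (hj : f j = 0) : False := by
  have h' : LinearIndepOn ℤ (fun i => ![f i, g i]) {i, j} :=
    h.comp (Subtype.val : ({i, j} : Set ι) → ι) Subtype.val_injective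
  have hpair := (LinearIndepOn.pair_iff (fun i => ![f i, g i]) hij).1 h'
  simp only [hi, hj] at hpair
  obtain ⟨-, h2⟩ := hpair (g j) (-g i) (by ext l; fin_cases l <;> simp [mul_comm])
  obtain ⟨h3, -⟩ := hpair 1 0 (by ext l; fin_cases l <;> simp [neg_eq_zero.1 h2])
  exact one_ne_zero h3

theorem exists_neighbors_of_adj [DecidableRel G.Adj] (hG : G.IsRegularOfDegree 3) {v x : V}
    (hx : G.Adj v x) : ∃ y z, x ≠ y ∧ x ≠ z ∧ y ≠ z ∧
      ∀ w, G.Adj v w ↔ w = x ∨ w = y ∨ w = z := by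
  classical
  have hcard : ((G.neighborFinset v).erase x).card = 2 := by
    rw [Finset.card_erase_of_mem (by simpa using hx), G.card_neighborFinset_eq_degree,
      hG.degree_eq]
  obtain ⟨y, z, hyz, h⟩ := Finset.card_eq_two.1 hcard
  have hmem : ∀ w, (w ≠ x ∧ G.Adj v w) ↔ w = y ∨ w = z := by
    intro w
    have := Finset.ext_iff.1 h w
    simpa using this
  refine ⟨y, z, ((hmem y).2 (Or.inl rfl)).1.symm, ((hmem z).2 (Or.inr rfl)).1.symm, hyz,
    fun w => ?_⟩
  by_cases hw : w = x
  · simp [hw, hx]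
  · rw [← hmem]
    simp [hw]

theorem exists_adj_of_regular [DecidableRel G.Adj] (hG : G.IsRegularOfDegree 3) (v : V) :
    ∃ x, G.Adj v x := by
  have : 0 < G.degree v := by rw [hG.degree_eq]; omega
  exact (G.degree_pos_iff_exists_adj v).1 this

theorem sum_edgeExtend_eq {v x y z : V} (hxy : x ≠ y) (hxz : x ≠ z) (hyz : y ≠ z)
    (h : ∀ w, G.Adj v w → w = x ∨ w = y ∨ w = z) (u : G.edgeSet → ℤ) :
    ∑ w, edgeExtend u s(v, w) =
      edgeExtend u s(v, x) + edgeExtend u s(v, y) + edgeExtend u s(v, z) := by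
  classical
  rw [← Finset.sum_subset (Finset.subset_univ {x, y, z}), Finset.sum_insert (by simp [hxy, hxz]),
    Finset.sum_pair hyz, add_assoc]
  intro w _ hw
  refine edgeExtend_of_notMem u fun h' => hw ?_
  simpa using h w h'

variable [Fintype G.edgeSet]

/-- Among independent generators, the ones through a vertex `v` stay independent when restricted to
two of the three edges at `v`. -/
theorem linearIndependent_restrict {ι : Type*} {α β : ι → G.edgeSet →₀ ℕ}
    (hαβ : ∀ i, (incidence G).mulVec (α i) = (incidence G).mulVec (β i))
    (hspan : Ideal.span (Set.range fun i =>
      (monomial (α i) 1 - monomial (β i) 1 : MvPolynomial G.edgeSet k)) =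
        toricIdeal k (incidence G))
    (hind : LinearIndependent ℤ fun i => expDiff (α i) (β i))
    {v x y z : V} (hxy : x ≠ y) (hxz : x ≠ z) (hyz : y ≠ z)
    (h : ∀ w, G.Adj v w ↔ w = x ∨ w = y ∨ w = z) :
    LinearIndependent ℤ fun i : {i // (incidence G).mulVec (α i) v ≠ 0} =>
      ![edgeExtend (expDiff (α i) (β i)) s(v, x), edgeExtend (expDiff (α i) (β i)) s(v, y)] := by
  have hvx : G.Adj v x := (h x).2 (by simp)
  have hvy : G.Adj v y := (h y).2 (by simp)
  let f : (G.edgeSet → ℤ) →ₗ[ℤ] (Fin 2 → ℤ) :=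
    LinearMap.pi ![LinearMap.proj ⟨s(v, x), hvx⟩, LinearMap.proj ⟨s(v, y), hvy⟩]
  have hf : ∀ u, f u = ![edgeExtend u s(v, x), edgeExtend u s(v, y)] := by
    intro u
    rw [edgeExtend_of_mem u hvx, edgeExtend_of_mem u hvy]
    ext i
    fin_cases i <;> rfl
  have hind' := hind.comp (Subtype.val : {i // (incidence G).mulVec (α i) v ≠ 0} → ι)
    Subtype.val_injective
  have := hind'.map (f := f) ?_
  · simpa only [Function.comp_def, hf] using this
  · rw [Submodule.disjoint_def]
    intro u hu hfu
    have huL : u ∈ relationLattice (incidence G) := by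
      refine Submodule.span_le.2 ?_ hu
      rintro _ ⟨i, rfl⟩
      exact mulVec_eq_iff.1 (hαβ i)
    rw [LinearMap.mem_ker, hf] at hfu
    have h1 : edgeExtend u s(v, x) = 0 := congrFun hfu 0
    have h2 : edgeExtend u s(v, y) = 0 := congrFun hfu 1
    have h3 : edgeExtend u s(v, z) = 0 := by
      have := mem_relationLattice_incidence.1 huL v
      rw [sum_edgeExtend_eq hxy hxz hyz (fun w => (h w).1), h1, h2] at this
      simpa using this
    -- A combination `u` of the generators through `v` that vanishes on two edges at `v` vanishes on
    -- the third, so it is also a combination of the generators avoiding `v`. Independence makes it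
    -- zero. The two monomials of a generator have equal degree at `v`, so both or neither meet the
    -- edges there.
    have hmem := mem_span_expDiff_of_vanishing hspan {e | v ∈ (e : Sym2 V)} (fun i => by
      have h4 := mulVec_incidence_ne_zero_iff (α := α i) (v := v)
      have h5 := mulVec_incidence_ne_zero_iff (α := β i) (v := v)
      rw [hαβ i] at h4
      exact h4.symm.trans h5) huL (by
      rintro ⟨e, he⟩ hve
      obtain ⟨w, rfl⟩ := Sym2.mem_iff_exists.1 hve
      rw [← edgeExtend_of_mem u he]
      rcases (h w).1 he with rfl | rfl | rfl <;> assumption)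
    have hdisj := hind.disjoint_span_image (s := {i | (incidence G).mulVec (α i) v ≠ 0})
      (t := {i | ∀ e ∈ {e : G.edgeSet | v ∈ (e : Sym2 V)}, α i e = 0}) (by
        rw [Set.disjoint_left]
        intro i hi hi'
        obtain ⟨e, he, he'⟩ := mulVec_incidence_ne_zero_iff.1 hi
        exact he' (hi' e he))
    refine (Submodule.disjoint_def.1 hdisj) u ?_ hmem
    rw [Set.range_comp] at hu
    simpa using hu

/-- If the toric ideal of a cubic graph is a complete intersection, then it is generated by the
quadrics of 4-cycles, two of them through each vertex, that have no two missed edges in common. -/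
theorem exists_cycles_of_isCompleteIntersection [DecidableRel G.Adj]
    (hG : G.IsRegularOfDegree 3) (hci : IsCompleteIntersection (graphIdeal k G)) :
    Module.finrank ℤ (relationLattice (incidence G)) + Fintype.card V ≤ Fintype.card G.edgeSet ∧
    ∃ (r : ℕ) (a b c d : Fin r → V),
      (∀ i, G.Adj (a i) (b i) ∧ G.Adj (b i) (c i) ∧ G.Adj (c i) (d i) ∧ G.Adj (a i) (d i) ∧
        a i ≠ c i ∧ b i ≠ d i) ∧
      (∀ v, {i | OnCycle (a i) (b i) (c i) (d i) v}.ncard = 2) ∧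
      ∀ v w i j, G.Adj v w → i ≠ j → OnCycle (a i) (b i) (c i) (d i) v →
        OnCycle (a j) (b j) (c j) (d j) v → IsCycleEdge (a i) (b i) (c i) (d i) s(v, w) ∨
          IsCycleEdge (a j) (b j) (c j) (d j) s(v, w) := by
  classical
  obtain ⟨r, α, β, hr, hαβ, hmin, hspan⟩ := exists_binomial_generators (k := k) (incidence G)
    fun α β => degree_eq_of_mulVec_incidence_eq
  set L := relationLattice (incidence G) with hL
  have hrL : r ≤ Module.finrank ℤ L := by
    have h1 : (Submodule.spanFinrank (toricIdeal k (incidence G)) : ℕ∞) =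
      (toricIdeal k (incidence G)).height := hci
    rw [height_toricIdeal] at h1
    have h2 : Submodule.spanFinrank (toricIdeal k (incidence G)) = Module.finrank ℤ L := by
      exact_mod_cast h1
    omega
  have hmemL : ∀ i, expDiff (α i) (β i) ∈ L := fun i => mulVec_eq_iff.1 (hαβ i)
  have hLspan : L = Submodule.span ℤ (Set.range fun i => expDiff (α i) (β i)) := by
    refine le_antisymm (fun u hu => ?_) (Submodule.span_le.2 ?_)
    · have := mem_span_expDiff_of_vanishing hspan ∅ (by simp) hu (by simp)
      simpa using this
    · rintro _ ⟨i, rfl⟩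
      exact hmemL i
  -- The `r` differences span a lattice of rank at least `r`.
  have hind : LinearIndependent ℤ fun i => expDiff (α i) (β i) := by
    have h1 : LinearIndependent ℤ fun i => (⟨expDiff (α i) (β i), hmemL i⟩ : L) := by
      refine linearIndependent_of_top_le_span_of_card_le_finrank ?_ (by simpa using hrL)
      rintro ⟨u, hu⟩ -
      have hu' := hu
      rw [hLspan] at hu'
      have h2 : (Set.range fun i => expDiff (α i) (β i)) =
          L.subtype '' (Set.range fun i => (⟨expDiff (α i) (β i), hmemL i⟩ : L)) := by
        rw [← Set.range_comp]; rfl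
      rw [h2, Submodule.span_image] at hu'
      obtain ⟨w, hw, hwu⟩ := hu'
      rwa [show (⟨u, hu⟩ : L) = w from Subtype.ext hwu.symm]
    exact h1.map' L.subtype (Submodule.ker_subtype L)
  have hfin : Module.finrank ℤ L ≤ r := by
    have h1 := finrank_range_le_card (R := ℤ) fun i => expDiff (α i) (β i)
    rwa [Set.finrank, ← hLspan, Fintype.card_fin] at h1
  have hrE : Fintype.card G.edgeSet ≤ r + Fintype.card V := by
    have h1 := card_edgeSet_le_finrank_add (G := G)
    rw [← hL] at h1
    omega
  let N : V → Finset (Fin r) := fun v => {i | (incidence G).mulVec (α i) v ≠ 0}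
  let W : Fin r → Finset V := fun i => {v | (incidence G).mulVec (α i) v ≠ 0}
  have hNcard : ∀ v, (N v).card ≤ 2 := by
    intro v
    obtain ⟨x, hx⟩ := exists_adj_of_regular hG v
    obtain ⟨y, z, hxy, hxz, hyz, h⟩ := exists_neighbors_of_adj hG hx
    have h1 := (linearIndependent_restrict hαβ hspan hind hxy hxz hyz h).fintype_card_le_finrank
    rw [Module.finrank_fintype_fun_eq_card, Fintype.card_fin] at h1
    rwa [Fintype.card_subtype] at h1
  have hW : ∀ i v, v ∈ W i ↔ (incidence G).mulVec (α i) v ≠ 0 := by simp [W]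
  have hcyc := fun i => four_le_card_and_exists_cycle (hαβ i) (hmin i) (hW i)
  have hdouble : ∑ v, (N v).card = ∑ i, (W i).card := by
    simp only [N, W, Finset.card_filter]
    exact Finset.sum_comm
  have h3 := three_mul_card_eq hG
  have hN2 : ∑ v, (N v).card ≤ 2 * Fintype.card V := by
    have := Finset.sum_le_card_nsmul Finset.univ (fun v => (N v).card) 2 fun v _ => hNcard v
    simpa [mul_comm] using this
  have hW4 : 4 * r ≤ ∑ i, (W i).card := by
    have := Finset.card_nsmul_le_sum Finset.univ (fun i => (W i).card) 4 fun i _ => (hcyc i).1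
    simpa [mul_comm] using this
  -- `4r ≤ ∑ |W i| = ∑ |N v| ≤ 2|V|`, while `r ≥ |E| - |V| = |V|/2`; equality holds throughout.
  have hNeq : ∀ v, (N v).card = 2 := by
    have : ∑ v, (N v).card = ∑ v : V, 2 := by
      simp only [Finset.sum_const, Finset.card_univ, smul_eq_mul]; omega
    intro v
    exact (Finset.sum_eq_sum_iff_of_le fun v _ => hNcard v).1 this v (Finset.mem_univ v)
  have hWeq : ∀ i, (W i).card = 4 := by
    have : ∑ i : Fin r, 4 = ∑ i, (W i).card := by
      simp only [Finset.sum_const, Finset.card_univ, smul_eq_mul, Fintype.card_fin]; omega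
    intro i
    exact ((Finset.sum_eq_sum_iff_of_le fun i _ => (hcyc i).1).1 this i (Finset.mem_univ i)).symm
  choose a b c d hab hbc hcd had hac hbd hWabcd hα hβ using fun i => (hcyc i).2 (hWeq i)
  refine ⟨by omega, r, a, b, c, d, fun i => ⟨hab i, hbc i, hcd i, had i, hac i, hbd i⟩, ?_, ?_⟩
  · intro v
    rw [← hNeq v, ← Set.ncard_coe_finset]
    congr 1
    ext i
    simp only [N, Set.mem_ofPred_eq, OnCycle, ← hWabcd, hW, Finset.coe_filter,
      Finset.mem_univ, true_and]
  · intro v w i j hvw hij hi hj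
    rw [OnCycle, ← hWabcd, hW] at hi hj
    by_contra hcon
    obtain ⟨y, z, hxy, hxz, hyz, h⟩ := exists_neighbors_of_adj hG hvw
    have hlin := linearIndependent_restrict hαβ hspan hind hxy hxz hyz h
    have hzero : ∀ l, ¬ IsCycleEdge (a l) (b l) (c l) (d l) s(v, w) →
        edgeExtend (expDiff (α l) (β l)) s(v, w) = 0 := by
      intro l hl
      rw [edgeExtend_of_mem _ hvw, hα, hβ]
      rw [IsCycleEdge] at hl
      push Not at hl
      have e1 : ∀ {x y : V} (h : G.Adj x y), s(v, w) ≠ s(x, y) →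
          (Finsupp.single (⟨s(x, y), h⟩ : G.edgeSet) 1 : G.edgeSet →₀ ℕ) ⟨s(v, w), hvw⟩ = 0 := by
        intro x y h hne
        exact Finsupp.single_eq_of_ne fun h' => hne (congrArg Subtype.val h')
      simp only [expDiff, Finsupp.coe_add, Pi.add_apply, e1 _ hl.1, e1 _ hl.2.1, e1 _ hl.2.2.1,
        e1 _ hl.2.2.2]
      simp
    push Not at hcon
    have hi0 := hzero i hcon.1
    have hj0 := hzero j hcon.2
    exact false_of_linearIndependent_of_eq_zero hlin
      (i := ⟨i, hi⟩) (j := ⟨j, hj⟩) (fun h => hij (congrArg Subtype.val h)) hi0 hj0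

end Counting

/-! ### The perfect matching of edges shared by two 4-cycles. -/

section Rungs

variable {V : Type*} {G : SimpleGraph V}

theorem IsCycleEdge.onCycle_left {a b c d v w : V} (h : IsCycleEdge a b c d s(v, w)) :
    OnCycle a b c d v := by
  simp only [IsCycleEdge, OnCycle, Sym2.eq_iff] at *
  tauto

theorem IsCycleEdge.swap {a b c d v w : V} (h : IsCycleEdge a b c d s(v, w)) :
    IsCycleEdge a b c d s(w, v) := by
  rwa [Sym2.eq_swap]

theorem OnCycle.exists_neighbors {a b c d v : V} (hab : G.Adj a b) (hbc : G.Adj b c)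
    (hcd : G.Adj c d) (had : G.Adj a d) (hac : a ≠ c) (hbd : b ≠ d) (h : OnCycle a b c d v) :
    ∃ p q, p ≠ q ∧ G.Adj v p ∧ G.Adj v q ∧ ∀ w, IsCycleEdge a b c d s(v, w) ↔ w = p ∨ w = q := by
  have := hab.ne; have := hbc.ne; have := hcd.ne; have := had.ne
  rcases h with rfl | rfl | rfl | rfl
  · refine ⟨b, d, hbd, hab, had, fun w => ?_⟩
    simp only [IsCycleEdge, Sym2.eq_iff]; grind
  · refine ⟨a, c, hac, hab.symm, hbc, fun w => ?_⟩
    simp only [IsCycleEdge, Sym2.eq_iff]; grind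
  · refine ⟨b, d, hbd, hbc.symm, hcd, fun w => ?_⟩
    simp only [IsCycleEdge, Sym2.eq_iff]; grind
  · refine ⟨a, c, hac, had.symm, hcd.symm, fun w => ?_⟩
    simp only [IsCycleEdge, Sym2.eq_iff]; grind

theorem IsCycleEdge.adj_opposite {a b c d v w x y : V} (hab : G.Adj a b) (hbc : G.Adj b c)
    (hcd : G.Adj c d) (had : G.Adj a d) (hac : a ≠ c) (hbd : b ≠ d)
    (hvw : IsCycleEdge a b c d s(v, w)) (hvx : IsCycleEdge a b c d s(v, x))
    (hwy : IsCycleEdge a b c d s(w, y)) (hxw : x ≠ w) (hyv : y ≠ v) : G.Adj x y := by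
  have := hab.ne; have := hbc.ne; have := hcd.ne; have := had.ne
  have := hab.symm; have := hbc.symm; have := hcd.symm; have := had.symm
  simp only [IsCycleEdge, Sym2.eq_iff] at hvw hvx hwy
  grind

variable [Fintype V]

/-- A system of 4-cycles in a cubic graph, two of them through each vertex and covering together
the three edges there, defines a perfect matching `τ` that preserves the remaining edges. -/
theorem exists_rungs [DecidableRel G.Adj] (hG : G.IsRegularOfDegree 3) {r : ℕ}
    {a b c d : Fin r → V}
    (hcyc : ∀ i, G.Adj (a i) (b i) ∧ G.Adj (b i) (c i) ∧ G.Adj (c i) (d i) ∧ G.Adj (a i) (d i) ∧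
      a i ≠ c i ∧ b i ≠ d i)
    (htwo : ∀ v, {i | OnCycle (a i) (b i) (c i) (d i) v}.ncard = 2)
    (hcover : ∀ v w i j, G.Adj v w → i ≠ j → OnCycle (a i) (b i) (c i) (d i) v →
      OnCycle (a j) (b j) (c j) (d j) v → IsCycleEdge (a i) (b i) (c i) (d i) s(v, w) ∨
        IsCycleEdge (a j) (b j) (c j) (d j) s(v, w)) :
    ∃ τ : V → V, (∀ v, G.Adj v (τ v)) ∧ (∀ v, τ (τ v) = v) ∧
      ∀ v w, G.Adj v w → w ≠ τ v → G.Adj (τ v) (τ w) := by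
  classical
  set On : Fin r → V → Prop := fun i => OnCycle (a i) (b i) (c i) (d i) with hOn
  set E : Fin r → Sym2 V → Prop := fun i => IsCycleEdge (a i) (b i) (c i) (d i) with hE
  -- The two cycles through `v` use two edges each and together cover all three, so exactly one edge
  -- `vm` is shared.
  have key : ∀ v, ∃ i j m, On i v ∧ On j v ∧ (∀ l, On l v → l = i ∨ l = j) ∧ G.Adj v m ∧
      (∀ w, E i s(v, w) ∧ E j s(v, w) ↔ w = m) ∧ ∀ w, G.Adj v w → E i s(v, w) ∨ E j s(v, w) := by
    intro v
    obtain ⟨i, j, hij, hset⟩ := Set.ncard_eq_two.1 (htwo v)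
    have hmem : ∀ l, On l v ↔ l = i ∨ l = j := fun l => Set.ext_iff.1 hset l
    have hi : On i v := (hmem i).2 (Or.inl rfl)
    have hj : On j v := (hmem j).2 (Or.inr rfl)
    obtain ⟨h1, h2, h3, h4, h5, h6⟩ := hcyc i
    obtain ⟨p, q, hpq, hvp, hvq, hEi⟩ := OnCycle.exists_neighbors h1 h2 h3 h4 h5 h6 hi
    obtain ⟨h1, h2, h3, h4, h5, h6⟩ := hcyc j
    obtain ⟨p', q', hpq', hvp', hvq', hEj⟩ := OnCycle.exists_neighbors h1 h2 h3 h4 h5 h6 hj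
    have hcov : ∀ w, G.Adj v w → E i s(v, w) ∨ E j s(v, w) := fun w hw =>
      hcover v w i j hw hij hi hj
    obtain ⟨y, z, hpy, hpz, hyz, hnb⟩ := exists_neighbors_of_adj hG hvp
    have hEi' : ∀ w, E i s(v, w) ↔ w = p ∨ w = q := hEi
    have hEj' : ∀ w, E j s(v, w) ↔ w = p' ∨ w = q' := hEj
    have c1 := hcov y ((hnb y).2 (by simp))
    have c2 := hcov z ((hnb z).2 (by simp))
    rw [hEi', hEj'] at c1 c2
    have n1 := (hnb q).1 hvq
    have n2 := (hnb p').1 hvp'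
    have n3 := (hnb q').1 hvq'
    have hm : ∃ m, G.Adj v m ∧ ∀ w, (w = p ∨ w = q) ∧ (w = p' ∨ w = q') ↔ w = m := by
      by_cases h : p' = p ∨ p' = q
      · exact ⟨p', hvp', fun w => by grind⟩
      · exact ⟨q', hvq', fun w => by grind⟩
    obtain ⟨m, hvm, hm⟩ := hm
    exact ⟨i, j, m, hi, hj, fun l => (hmem l).1, hvm, fun w => by rw [hEi', hEj', hm], hcov⟩
  choose i j τ hi hj hmem hτ huniq hcov using key
  have hEτ : ∀ v l, On l v → E l s(v, τ v) := by
    intro v l hl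
    have := (huniq v (τ v)).2 rfl
    rcases hmem v l hl with rfl | rfl
    exacts [this.1, this.2]
  -- Both cycles through `v` run along the edge to `τ v`. They are therefore the two cycles through
  -- `τ v`, and `v` is the neighbour they share there.
  have hττ : ∀ v, τ (τ v) = v := by
    intro v
    have hsub : {l | On l v} ⊆ {l | On l (τ v)} := fun l hl =>
      (IsCycleEdge.swap (hEτ v l hl)).onCycle_left
    have heq := Set.eq_of_subset_of_ncard_le hsub (by
      rw [show {l | On l v}.ncard = 2 from htwo v, show {l | On l (τ v)}.ncard = 2 from htwo (τ v)])
    have h1 : ∀ l, On l (τ v) → E l s(τ v, v) := fun l hl =>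
      IsCycleEdge.swap (hEτ v l ((Set.ext_iff.1 heq l).2 hl))
    exact ((huniq (τ v) v).1 ⟨h1 _ (hi _), h1 _ (hj _)⟩).symm
  refine ⟨τ, hτ, hττ, fun v w hvw hw => ?_⟩
  obtain ⟨l, hlv, hl⟩ : ∃ l, On l v ∧ E l s(v, w) := by
    rcases hcov v w hvw with h | h
    exacts [⟨_, hi v, h⟩, ⟨_, hj v, h⟩]
  obtain ⟨h1, h2, h3, h4, h5, h6⟩ := hcyc l
  -- On the cycle containing the side `vw`, the adjacent edges are the rungs at `v` and `w`, so its
  -- opposite edge joins `τ v` to `τ w`.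
  refine IsCycleEdge.adj_opposite h1 h2 h3 h4 h5 h6 hl (hEτ v l hlv)
    (hEτ w l (IsCycleEdge.swap hl).onCycle_left) hw.symm ?_
  rintro h
  exact hw (by rw [← h, hττ])

end Rungs

/-! ### From a rung involution to a band or Möbius band. -/

section Labelling

variable {V : Type*} {G : SimpleGraph V}

/-- A graph with a perfect matching `τ` (the rungs) such that each vertex lies on exactly two
further edges (the sides), and such that `τ` preserves the sides. -/
structure IsRungInvolution (G : SimpleGraph V) (τ : V → V) : Prop where
  adj : ∀ v, G.Adj v (τ v)
  invol : ∀ v, τ (τ v) = v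
  map_side : ∀ v w, G.Adj v w → w ≠ τ v → G.Adj (τ v) (τ w)
  exists_sides : ∀ v, ∃ p q, p ≠ q ∧ ∀ w, (G.Adj v w ∧ w ≠ τ v) ↔ w = p ∨ w = q

namespace IsRungInvolution

variable {τ : V → V}

theorem injective (h : IsRungInvolution G τ) : Function.Injective τ := fun v w hvw => by
  rw [← h.invol v, hvw, h.invol]

theorem ne (h : IsRungInvolution G τ) (v : V) : τ v ≠ v := (h.adj v).ne'

theorem side_symm (h : IsRungInvolution G τ) {v w : V} (hs : G.Adj v w ∧ w ≠ τ v) :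
    G.Adj w v ∧ v ≠ τ w :=
  ⟨hs.1.symm, fun hv => hs.2 (by rw [hv, h.invol])⟩

theorem side_map (h : IsRungInvolution G τ) {v w : V} (hs : G.Adj v w ∧ w ≠ τ v) :
    G.Adj (τ v) (τ w) ∧ τ w ≠ τ (τ v) :=
  ⟨h.map_side v w hs.1 hs.2, fun hv => hs.2 (h.injective hv)⟩

/-- The walk along the sides that starts at a given vertex and never turns back. -/
theorem exists_side_walk (h : IsRungInvolution G τ) (v : V) : ∃ a : ℕ → V, a 0 = v ∧
    (∀ i, G.Adj (a i) (a (i + 1)) ∧ a (i + 1) ≠ τ (a i)) ∧ (∀ i, a (i + 2) ≠ a i) ∧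
    ∀ i w, G.Adj (a (i + 1)) w → w ≠ τ (a (i + 1)) → w = a i ∨ w = a (i + 2) := by
  have hnext : ∀ p x, ∃ q, (G.Adj x p ∧ p ≠ τ x) →
      q ≠ p ∧ ∀ w, (G.Adj x w ∧ w ≠ τ x) ↔ w = p ∨ w = q := by
    intro p x
    obtain ⟨y, z, hyz, hx⟩ := h.exists_sides x
    by_cases hp : p = y
    · exact ⟨z, fun _ => ⟨hp ▸ hyz.symm, by rw [hp]; exact hx⟩⟩
    · refine ⟨y, fun hs => ⟨Ne.symm hp, fun w => ?_⟩⟩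
      have : p = z := ((hx p).1 hs).resolve_left hp
      rw [hx, this, or_comm]
  choose next hnext using hnext
  obtain ⟨y, z, -, hy⟩ := h.exists_sides v
  -- The state of the walk is the pair of the current vertex and its successor, since the next step
  -- depends on both.
  let P : ℕ → V × V := fun i => Nat.rec (v, y) (fun _ q => (q.2, next q.1 q.2)) i
  have hP : ∀ i, (P (i + 1)).2 = next (P i).1 (P (i + 1)).1 := fun i => rfl
  have hside : ∀ i, G.Adj (P i).1 (P (i + 1)).1 ∧ (P (i + 1)).1 ≠ τ (P i).1 := by
    intro i
    induction i with
    | zero => exact (hy y).2 (Or.inl rfl)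
    | succ i ih => exact ((hnext (P i).1 (P (i + 1)).1 (h.side_symm ih)).2 _).2 (Or.inr rfl)
  refine ⟨fun i => (P i).1, rfl, hside, fun i => ?_, fun i w hadj hneq => ?_⟩
  · exact (hnext (P i).1 (P (i + 1)).1 (h.side_symm (hside i))).1
  · exact ((hnext (P i).1 (P (i + 1)).1 (h.side_symm (hside i))).2 w).1 ⟨hadj, hneq⟩

/-- A side walk first returns to the rungs that it has visited at its initial rung. -/
theorem exists_first_return (h : IsRungInvolution G τ) [Finite V] {a : ℕ → V}
    (hs : ∀ i, G.Adj (a i) (a (i + 1)) ∧ a (i + 1) ≠ τ (a i)) (hne : ∀ i, a (i + 2) ≠ a i)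
    (hnb : ∀ i w, G.Adj (a (i + 1)) w → w ≠ τ (a (i + 1)) → w = a i ∨ w = a (i + 2)) :
    ∃ n, 1 ≤ n ∧ (a (n + 1) = a 0 ∨ a (n + 1) = τ (a 0)) ∧
      ∀ i j, i < j → j ≤ n → a j ≠ a i ∧ a j ≠ τ (a i) := by
  classical
  have hex : ∃ j, ∃ i < j, a j = a i ∨ a j = τ (a i) := by
    obtain ⟨i, j, hij, hne⟩ := Finite.exists_ne_map_eq_of_infinite a
    rcases lt_or_gt_of_ne hij with hlt | hlt
    exacts [⟨j, i, hlt, Or.inl hne.symm⟩, ⟨i, j, hlt, Or.inl hne⟩]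
  obtain ⟨i, hi, hai⟩ := Nat.find_spec hex
  have hmin : ∀ i j, i < j → j < Nat.find hex → a j ≠ a i ∧ a j ≠ τ (a i) := by
    intro i j hij hj
    have := Nat.find_min hex hj
    push Not at this
    exact this i hij
  set R := Nat.find hex
  have hsucc : R ≠ i + 1 := by
    intro hR
    rw [hR] at hai
    rcases hai with h' | h'
    exacts [(hs i).1.ne h'.symm, (hs i).2 h']
  obtain ⟨n, hn⟩ : ∃ n, R = n + 1 := ⟨R - 1, by omega⟩
  rw [hn] at hai hmin hsucc hi
  -- If the rung met again were that of `a (l + 1)`, then `a n` or `τ (a n)` would be a side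
  -- neighbour of `a (l + 1)`, hence equal to `a l` or `a (l + 2)`. An earlier repetition, or for `n
  -- = l + 2` a reversal of the walk or a fixed point of `τ`, would result.
  have hi0 : i = 0 := by
    by_contra hi0
    obtain ⟨l, rfl⟩ : ∃ l, i = l + 1 := ⟨i - 1, by omega⟩
    have hprev := h.side_symm (hs n)
    have hcases : ∀ x, (x = a n ∧ n ≠ l + 2 ∨ x = τ (a n)) → (x = a l ∨ x = a (l + 2)) → False := by
      intro x hx hx'
      have hl : a n ≠ a l ∧ a n ≠ τ (a l) := hmin l n (by omega) (by omega)
      have hτl : τ (a n) ≠ a l := fun h' => hl.2 (by rw [← h', h.invol])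
      by_cases hn2 : n = l + 2
      · subst hn2
        rcases hx with hx | rfl
        · exact hx.2 rfl
        · rcases hx' with h' | h'
          exacts [hτl h', h.ne _ h']
      · have hl2 : a n ≠ a (l + 2) ∧ a n ≠ τ (a (l + 2)) := hmin (l + 2) n (by omega) (by omega)
        have hτl2 : τ (a n) ≠ a (l + 2) := fun h' => hl2.2 (by rw [← h', h.invol])
        rcases hx with ⟨rfl, -⟩ | rfl <;> rcases hx' with h' | h'
        exacts [hl.1 h', hl2.1 h', hτl h', hτl2 h']
    rcases hai with h' | h'
    · rw [h'] at hprev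
      refine hcases _ (Or.inl ⟨rfl, ?_⟩) (hnb l _ hprev.1 hprev.2)
      rintro rfl
      exact hne (l + 1) h'
    · rw [h'] at hprev
      have hprev' := h.side_map hprev
      rw [h.invol] at hprev'
      exact hcases _ (Or.inr rfl) (hnb l _ hprev'.1 hprev'.2)
  subst hi0
  exact ⟨n, by omega, hai, fun i j hij hj => hmin i j hij (by omega)⟩

/-- `K` stands for the pair of closing edges, so that both kinds of band are handled together. The
chain and `K` account for all edges at each `a i`, and by the symmetry `τ` for all edges at each `τ
(a i)`. The labelled vertices are thus closed under adjacency and exhaust the connected graph. -/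
theorem edgeSet_eq_of_closing (h : IsRungInvolution G τ) (hG : G.Connected) {a : ℕ → V} {n : ℕ}
    (hs : ∀ i, G.Adj (a i) (a (i + 1)) ∧ a (i + 1) ≠ τ (a i))
    (hnb : ∀ i w, G.Adj (a (i + 1)) w → w ≠ τ (a (i + 1)) → w = a i ∨ w = a (i + 2))
    (hn : 1 ≤ n) {K : Set (Sym2 V)} (hKadj : K ⊆ G.edgeSet) (hKτ : ∀ e ∈ K, e.map τ ∈ K)
    (hK0 : ∀ w, G.Adj (a 0) w → w ≠ τ (a 0) → w = a 1 ∨ s(a 0, w) ∈ K)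
    (hKn : s(a n, a (n + 1)) ∈ K)
    (hKS : ∀ x y, s(x, y) ∈ K → ∃ i : Fin (n + 1), y = a i ∨ y = τ (a i)) :
    (∀ x, ∃ i : Fin (n + 1), x = a i ∨ x = τ (a i)) ∧
      G.edgeSet = chainEdges (fun i : Fin (n + 1) => a i) (fun i => τ (a i)) ∪ K := by
  set E := chainEdges (fun i : Fin (n + 1) => a i) (fun i => τ (a i)) ∪ K with hE
  have hEτ : ∀ e ∈ E, e.map τ ∈ E := by
    rintro e ((⟨i, rfl | rfl⟩ | ⟨j, rfl⟩) | he)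
    · exact Or.inl (Or.inl ⟨i, Or.inr rfl⟩)
    · refine Or.inl (Or.inl ⟨i, Or.inl ?_⟩)
      simp [h.invol]
    · refine Or.inl (Or.inr ⟨j, ?_⟩)
      simp [h.invol, Sym2.eq_swap]
    · exact Or.inr (hKτ e he)
  have hfwd : ∀ (i : Fin (n + 1)) (y : V), G.Adj (a i) y → s(a i, y) ∈ E := by
    intro i y hy
    by_cases hyτ : y = τ (a i)
    · exact Or.inl (Or.inr ⟨i, by rw [hyτ]⟩)
    obtain ⟨i, hi⟩ := i
    rcases Nat.eq_zero_or_pos i with rfl | hpos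
    · rcases hK0 y hy hyτ with rfl | hy'
      · exact Or.inl (Or.inl ⟨⟨0, by omega⟩, Or.inl rfl⟩)
      · exact Or.inr hy'
    · obtain ⟨l, rfl⟩ : ∃ l, i = l + 1 := ⟨i - 1, by omega⟩
      rcases hnb l y hy hyτ with rfl | rfl
      · exact Or.inl (Or.inl ⟨⟨l, by omega⟩, Or.inl Sym2.eq_swap⟩)
      · by_cases hl : l + 1 = n
        · subst hl
          exact Or.inr hKn
        · exact Or.inl (Or.inl ⟨⟨l + 1, by omega⟩, Or.inl rfl⟩)
  have hfwd' : ∀ (i : Fin (n + 1)) (x y : V), (x = a i ∨ x = τ (a i)) →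
      G.Adj x y → s(x, y) ∈ E := by
    rintro i x y (rfl | rfl) hxy
    · exact hfwd i y hxy
    · by_cases hy : y = a i
      · refine Or.inl (Or.inr ⟨i, ?_⟩)
        rw [hy, Sym2.eq_swap]
      · have h1 := h.map_side _ _ hxy (by rwa [h.invol])
        rw [h.invol] at h1
        have h2 := hEτ _ (hfwd i _ h1)
        rwa [Sym2.map_mk, h.invol] at h2
  have hS : ∀ x y, s(x, y) ∈ E → ∃ i : Fin (n + 1), y = a i ∨ y = τ (a i) := by
    rintro x y ((⟨i, hi | hi⟩ | ⟨j, hj⟩) | he)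
    · rcases Sym2.eq_iff.1 hi with ⟨-, rfl⟩ | ⟨-, rfl⟩
      exacts [⟨i.succ, Or.inl rfl⟩, ⟨i.castSucc, Or.inl rfl⟩]
    · rcases Sym2.eq_iff.1 hi with ⟨-, rfl⟩ | ⟨-, rfl⟩
      exacts [⟨i.succ, Or.inr rfl⟩, ⟨i.castSucc, Or.inr rfl⟩]
    · rcases Sym2.eq_iff.1 hj with ⟨-, rfl⟩ | ⟨-, rfl⟩
      exacts [⟨j, Or.inr rfl⟩, ⟨j, Or.inl rfl⟩]
    · exact hKS x y he
  have hsurj : ∀ x, ∃ i : Fin (n + 1), x = a i ∨ x = τ (a i) := by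
    intro x
    obtain ⟨p⟩ := hG.preconnected (a 0) x
    have : ∀ {y z : V} (_ : G.Walk y z), (∃ i : Fin (n + 1), y = a i ∨ y = τ (a i)) →
        ∃ i : Fin (n + 1), z = a i ∨ z = τ (a i) := by
      intro y z p
      induction p with
      | nil => exact id
      | cons hadj _ ih =>
        rintro ⟨i, hi⟩
        exact ih (hS _ _ (hfwd' i _ _ hi hadj))
    exact this p ⟨0, Or.inl rfl⟩
  refine ⟨hsurj, Set.Subset.antisymm ?_ ?_⟩
  · intro e he
    induction e using Sym2.ind with
    | _ x y =>
      obtain ⟨i, hi⟩ := hsurj x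
      exact hfwd' i x y hi he
  · rintro e ((⟨i, rfl | rfl⟩ | ⟨j, rfl⟩) | he)
    · exact (hs i).1
    · exact (h.side_map (hs i)).1
    · exact h.adj _
    · exact hKadj he

/-- A connected graph with a rung involution is a band or a Möbius band. -/
theorem exists_isBand_or_isMobiusBand (h : IsRungInvolution G τ) [Finite V] (hG : G.Connected) :
    ∃ (n : ℕ) (a b : Fin (n + 1) → V), IsBand G a b ∨ IsMobiusBand G a b := by
  obtain ⟨v⟩ := hG.nonempty
  obtain ⟨a, -, hs, hne, hnb⟩ := h.exists_side_walk v
  obtain ⟨n, hn, hret, hdist⟩ := h.exists_first_return hs hne hnb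
  have hinj : Function.Injective
      (Sum.elim (fun i : Fin (n + 1) => a i) (fun i : Fin (n + 1) => τ (a i))) := by
    have h1 : ∀ i j : Fin (n + 1), a i = a j ∨ a i = τ (a j) → i = j := by
      intro i j hij
      rcases lt_trichotomy i j with hlt | heq | hgt
      · have := hdist i j hlt (by omega)
        rcases hij with h' | h'
        · exact absurd h'.symm this.1
        · exact absurd (by rw [h', h.invol]) this.2
      · exact heq
      · have := hdist j i hgt (by omega)
        rcases hij with h' | h'
        exacts [absurd h' this.1, absurd h' this.2]
    rintro (i | i) (j | j) hij
    · rw [h1 i j (Or.inl hij)]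
    · have := h1 i j (Or.inr hij)
      subst this
      exact absurd hij.symm (h.ne _)
    · have := h1 j i (Or.inr hij.symm)
      subst this
      exact absurd hij (h.ne _)
    · rw [h1 i j (Or.inl (h.injective hij))]
  have hbij : (∀ x, ∃ i : Fin (n + 1), x = a i ∨ x = τ (a i)) → Function.Bijective
      (Sum.elim (fun i : Fin (n + 1) => a i) (fun i : Fin (n + 1) => τ (a i))) := by
    refine fun hsurj => ⟨hinj, fun x => ?_⟩
    obtain ⟨i, hi | hi⟩ := hsurj x
    exacts [⟨Sum.inl i, hi.symm⟩, ⟨Sum.inr i, hi.symm⟩]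
  refine ⟨n, fun i => a i, fun i => τ (a i), ?_⟩
  -- A return to `a 0` itself closes up a band, a return to `τ (a 0)` a Möbius band.
  rcases hret with hret | hret
  · left
    -- The side neighbour `a 1` of `a 0 = a (n + 1)` is `a n` or `a (n + 2)`. The former would
    -- repeat a vertex or, for `n = 1`, turn the walk back.
    have ha1 : a 1 = a (n + 2) := by
      refine (hnb n (a 1) (by rw [hret]; exact (hs 0).1)
        (by rw [hret]; exact (hs 0).2)).resolve_left
        fun h' => ?_
      rcases Nat.lt_or_ge 1 n with h1 | h1
      · exact (hdist 1 n h1 le_rfl).1 h'.symm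
      · have : n = 1 := by omega
        subst this
        exact hne 0 hret
    obtain ⟨h1, h2⟩ := h.edgeSet_eq_of_closing hG hs hnb hn
      (K := {s(a 0, a n), s(τ (a 0), τ (a n))})
      (by
        rintro e (rfl | rfl)
        · exact hret ▸ (hs n).1.symm
        · exact hret ▸ (h.side_map (hs n)).1.symm)
      (by
        rintro e (rfl | rfl)
        · exact Or.inr rfl
        · left; simp [h.invol])
      (by
        intro w hw hw'
        rw [← hret] at hw hw'
        rcases hnb n w hw hw' with rfl | rfl
        · exact Or.inr (Or.inl rfl)
        · exact Or.inl ha1.symm)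
      (by rw [hret]; exact Or.inl Sym2.eq_swap)
      (by
        rintro x y (he | he)
        · rcases Sym2.eq_iff.1 he with ⟨-, rfl⟩ | ⟨-, rfl⟩
          exacts [⟨Fin.last n, Or.inl rfl⟩, ⟨0, Or.inl rfl⟩]
        · rcases Sym2.eq_iff.1 he with ⟨-, rfl⟩ | ⟨-, rfl⟩
          exacts [⟨Fin.last n, Or.inr rfl⟩, ⟨0, Or.inr rfl⟩])
    exact ⟨hbij h1, h2⟩
  · right
    have hret' : τ (a (n + 1)) = a 0 := by rw [hret, h.invol]
    have ha1 : τ (a 1) = a (n + 2) := by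
      have h0 := h.side_map (hs 0)
      rw [← hret] at h0
      refine (hnb n _ h0.1 h0.2).resolve_left fun h' => ?_
      rcases Nat.lt_or_ge 1 n with h1 | h1
      · exact (hdist 1 n h1 le_rfl).2 h'.symm
      · have : n = 1 := by omega
        subst this
        exact h.ne _ h'
    obtain ⟨h1, h2⟩ := h.edgeSet_eq_of_closing hG hs hnb hn
      (K := {s(a 0, τ (a n)), s(a n, τ (a 0))})
      (by
        rintro e (rfl | rfl)
        · have := (h.side_map (hs n)).1.symm
          rwa [hret'] at this
        · exact hret ▸ (hs n).1)
      (by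
        rintro e (rfl | rfl)
        · right; simp [h.invol, Sym2.eq_swap]
        · left; simp [h.invol, Sym2.eq_swap])
      (by
        intro w hw hw'
        have h0 := h.side_map ⟨hw, hw'⟩
        rw [← hret] at h0
        rcases hnb n _ h0.1 h0.2 with h' | h'
        · right; left
          rw [← h', h.invol]
        · left
          exact h.injective (h'.trans ha1.symm))
      (by rw [hret]; exact Or.inr rfl)
      (by
        rintro x y (he | he)
        · rcases Sym2.eq_iff.1 he with ⟨-, rfl⟩ | ⟨-, rfl⟩
          exacts [⟨Fin.last n, Or.inr rfl⟩, ⟨0, Or.inl rfl⟩]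
        · rcases Sym2.eq_iff.1 he with ⟨-, rfl⟩ | ⟨-, rfl⟩
          exacts [⟨0, Or.inr rfl⟩, ⟨Fin.last n, Or.inl rfl⟩])
    exact ⟨hbij h1, h2⟩

end IsRungInvolution

end Labelling

/-! ### Bipartiteness of bands of the wrong parity. -/

section Parity

variable {V : Type*} {G : SimpleGraph V} {n : ℕ} {a b : Fin (n + 1) → V}

/-- The signs that alternate along the chain. -/
theorem exists_alternating_signs (hbij : Function.Bijective (Sum.elim a b)) :
    ∃ y : V → ℤ, (∀ i, y (a i) = (-1) ^ (i : ℕ)) ∧ (∀ i, y (b i) = -(-1) ^ (i : ℕ)) ∧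
      ∀ v w, s(v, w) ∈ chainEdges a b → y v + y w = 0 := by
  let e := Equiv.ofBijective _ hbij
  let y : V → ℤ := fun v => Sum.elim (fun i : Fin (n + 1) => (-1 : ℤ) ^ (i : ℕ))
    (fun i : Fin (n + 1) => -(-1 : ℤ) ^ (i : ℕ)) (e.symm v)
  have hya : ∀ i, y (a i) = (-1) ^ (i : ℕ) := by
    intro i
    have : e.symm (a i) = Sum.inl i := e.symm_apply_apply (Sum.inl i)
    simp [y, this]
  have hyb : ∀ i, y (b i) = -(-1) ^ (i : ℕ) := by
    intro i
    have : e.symm (b i) = Sum.inr i := e.symm_apply_apply (Sum.inr i)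
    simp [y, this]
  refine ⟨y, hya, hyb, ?_⟩
  rintro v w (⟨i, hi | hi⟩ | ⟨j, hj⟩)
  · rcases Sym2.eq_iff.1 hi with ⟨rfl, rfl⟩ | ⟨rfl, rfl⟩ <;> simp [hya, pow_succ]
  · rcases Sym2.eq_iff.1 hi with ⟨rfl, rfl⟩ | ⟨rfl, rfl⟩ <;> simp [hyb, pow_succ]
  · rcases Sym2.eq_iff.1 hj with ⟨rfl, rfl⟩ | ⟨rfl, rfl⟩ <;> simp [hya, hyb]

/-- When `n + 1` is even, `a 0` and `a n` carry opposite signs, and so do `b 0` and `b n`, so the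
closing edges respect the alternating signs. -/
theorem IsBand.exists_signs (h : IsBand G a b) (hn : ¬ Odd (n + 1)) :
    ∃ y : V → ℤ, y (a 0) = 1 ∧ ∀ v w, G.Adj v w → y v + y w = 0 := by
  obtain ⟨y, hya, hyb, hy⟩ := exists_alternating_signs h.bijective
  have hpow : (-1 : ℤ) ^ n = -1 := by
    have : Odd n := by
      rw [Nat.not_odd_iff_even, Nat.even_add_one, Nat.not_even_iff_odd] at hn
      exact hn
    exact this.neg_one_pow
  refine ⟨y, by simp [hya], fun v w hvw => ?_⟩
  have hvw' : s(v, w) ∈ G.edgeSet := hvw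
  rw [h.edgeSet_eq] at hvw'
  rcases hvw' with h' | h' | h'
  · exact hy v w h'
  · rcases Sym2.eq_iff.1 h' with ⟨rfl, rfl⟩ | ⟨rfl, rfl⟩ <;> simp [hya, hpow]
  · rcases Sym2.eq_iff.1 h' with ⟨rfl, rfl⟩ | ⟨rfl, rfl⟩ <;> simp [hyb, hpow]

/-- When `n + 1` is odd, `a 0` and `a n` carry the same sign, so the crossed closing edges join
opposite signs. -/
theorem IsMobiusBand.exists_signs (h : IsMobiusBand G a b) (hn : ¬ Even (n + 1)) :
    ∃ y : V → ℤ, y (a 0) = 1 ∧ ∀ v w, G.Adj v w → y v + y w = 0 := by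
  obtain ⟨y, hya, hyb, hy⟩ := exists_alternating_signs h.bijective
  have hpow : (-1 : ℤ) ^ n = 1 := by
    rw [Nat.even_add_one, not_not] at hn
    exact hn.neg_one_pow
  refine ⟨y, by simp [hya], fun v w hvw => ?_⟩
  have hvw' : s(v, w) ∈ G.edgeSet := hvw
  rw [h.edgeSet_eq] at hvw'
  rcases hvw' with h' | h' | h'
  · exact hy v w h'
  · rcases Sym2.eq_iff.1 h' with ⟨rfl, rfl⟩ | ⟨rfl, rfl⟩ <;> simp [hya, hyb, hpow]
  · rcases Sym2.eq_iff.1 h' with ⟨rfl, rfl⟩ | ⟨rfl, rfl⟩ <;> simp [hya, hyb, hpow]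

end Parity

/-! ### Necessity of the band structure. -/

section Components

variable {k : Type*} [Field k] {V : Type*} [Fintype V] {G : SimpleGraph V}

theorem isOddBand_or_isEvenMobiusBand_of_isCompleteIntersection [DecidableRel G.Adj]
    (hG : G.IsRegularOfDegree 3) (hci : IsCompleteIntersection (graphIdeal k G))
    (c : G.ConnectedComponent) :
    IsOddBand c.toSimpleGraph ∨ IsEvenMobiusBand c.toSimpleGraph := by
  classical
  obtain ⟨hrank, r, a, b, c', d, hcyc, htwo, hcover⟩ :=
    exists_cycles_of_isCompleteIntersection hG hci
  obtain ⟨τ, hτ, hττ, hside⟩ := exists_rungs hG hcyc htwo hcover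
  have hmem : ∀ x : c, τ x ∈ c.supp := fun x =>
    (SimpleGraph.ConnectedComponent.mem_supp_congr_adj c (hτ x)).1 x.2
  let τc : c → c := fun x => ⟨τ x, hmem x⟩
  have hadj : ∀ x y : c, c.toSimpleGraph.Adj x y ↔ G.Adj x y := fun x y => Iff.rfl
  have hrung : IsRungInvolution c.toSimpleGraph τc := by
    refine ⟨fun x => hτ x, fun x => Subtype.ext (hττ x), fun x y hxy hne => ?_, fun x => ?_⟩
    · exact hside x y hxy fun h => hne (Subtype.ext h)
    · obtain ⟨y, z, h1, h2, h3, h4⟩ := exists_neighbors_of_adj hG (hτ x)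
      have hy : G.Adj x y := (h4 y).2 (by simp)
      have hz : G.Adj x z := (h4 z).2 (by simp)
      have hyc := (SimpleGraph.ConnectedComponent.mem_supp_congr_adj c hy).1 x.2
      have hzc := (SimpleGraph.ConnectedComponent.mem_supp_congr_adj c hz).1 x.2
      refine ⟨⟨y, hyc⟩, ⟨z, hzc⟩, fun h => h3 (congrArg Subtype.val h), fun w => ?_⟩
      rw [hadj, h4]
      simp only [ne_eq, Subtype.ext_iff, τc]
      grind
  have hsigns : ∀ (x : c) (y : c → ℤ), y x = 1 →
      (∀ v w, c.toSimpleGraph.Adj v w → y v + y w = 0) → False := by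
    intro x y hx hy
    -- Extended by zero to the other components, signs on a bipartite component contradict the
    -- minimality of the rank.
    have h0 := eq_zero_of_forall_adj_add_eq_zero hrank
      (y := fun v => if h : v ∈ c.supp then y ⟨v, h⟩ else 0) (by
        intro v w hvw
        by_cases hv : v ∈ c.supp
        · have hw := (SimpleGraph.ConnectedComponent.mem_supp_congr_adj c hvw).1 hv
          simp only [dif_pos hv, dif_pos hw]
          exact hy ⟨v, hv⟩ ⟨w, hw⟩ hvw
        · have hw := mt (SimpleGraph.ConnectedComponent.mem_supp_congr_adj c hvw).2 hv
          simp only [dif_neg hv, dif_neg hw, add_zero])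
    have h1 := congrFun h0 x
    rw [dif_pos (show (x : V) ∈ c.supp from x.2)] at h1
    rw [show (⟨x, x.2⟩ : c) = x from rfl, hx] at h1
    exact one_ne_zero h1
  obtain ⟨n, p, q, h | h⟩ := hrung.exists_isBand_or_isMobiusBand c.connected_toSimpleGraph
  · left
    refine ⟨n, p, q, ?_, h⟩
    by_contra hn
    obtain ⟨y, hy0, hy⟩ := h.exists_signs hn
    exact hsigns (p 0) y hy0 hy
  · right
    refine ⟨n, p, q, ?_, h⟩
    by_contra hn
    obtain ⟨y, hy0, hy⟩ := h.exists_signs hn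
    exact hsigns (p 0) y hy0 hy

end Components

/-! ### Ladders and the generation of their toric ideal by quadrics. -/

section Ladder

open MvPolynomial

variable {V : Type*}

/-- The edges of `G` are the pairs `{v, τ v}` and `{v, σ v}`, where `τ` is an involution that
commutes with the permutation `σ` (with inverse `ρ`), and some odd power of `σ` fixes `v` or some
even power of `σ` sends `v` to `τ v`. -/
structure IsLadder (G : SimpleGraph V) (σ ρ τ : V → V) : Prop where
  left_inv : ∀ v, ρ (σ v) = v
  right_inv : ∀ v, σ (ρ v) = v
  invol : ∀ v, τ (τ v) = v
  comm : ∀ v, σ (τ v) = τ (σ v)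
  adj_rung : ∀ v, G.Adj v (τ v)
  adj_side : ∀ v, G.Adj v (σ v)
  neighbor : ∀ v w, G.Adj v w → w = τ v ∨ w = σ v ∨ w = ρ v
  parity : ∀ v, ∃ r, (Odd r ∧ σ^[r] v = v) ∨ (Even r ∧ σ^[r] v = τ v)

/-- The variable of an edge of `G`, extended by zero to all pairs of vertices. -/
noncomputable def edgeVar (k : Type*) [Field k] (G : SimpleGraph V) (s : Sym2 V) :
    MvPolynomial G.edgeSet k :=
  open Classical in if h : s ∈ G.edgeSet then X ⟨s, h⟩ else 0

theorem edgeVar_of_mem (k : Type*) [Field k] {G : SimpleGraph V} {s : Sym2 V}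
    (h : s ∈ G.edgeSet) : edgeVar k G s = X ⟨s, h⟩ := dif_pos h

/-- The quadric of the 4-cycle through the rungs of `v` and `σ v`. -/
noncomputable def ladderQuadric (k : Type*) [Field k] (G : SimpleGraph V) (σ τ : V → V) (v : V) :
    MvPolynomial G.edgeSet k :=
  edgeVar k G s(v, τ v) * edgeVar k G s(σ v, τ (σ v)) -
    edgeVar k G s(v, σ v) * edgeVar k G s(τ v, σ (τ v))

namespace IsLadder

variable {G : SimpleGraph V} {σ ρ τ : V → V}

theorem adj_inv (h : IsLadder G σ ρ τ) (v : V) : G.Adj v (ρ v) := by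
  have := (h.adj_side (ρ v)).symm
  rwa [h.right_inv] at this

theorem comm_inv (h : IsLadder G σ ρ τ) (v : V) : ρ (τ v) = τ (ρ v) := by
  have := h.comm (ρ v)
  rw [h.right_inv] at this
  rw [← this, h.left_inv]

/-- The rung of a vertex as an edge. -/
def rung (h : IsLadder G σ ρ τ) (v : V) : G.edgeSet := ⟨s(v, τ v), h.adj_rung v⟩

/-- The side leading from `v` to `σ v` as an edge. -/
def side (h : IsLadder G σ ρ τ) (v : V) : G.edgeSet := ⟨s(v, σ v), h.adj_side v⟩

theorem ladderQuadric_eq (h : IsLadder G σ ρ τ) (k : Type*) [Field k] (v : V) :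
    ladderQuadric k G σ τ v =
      (monomial (Finsupp.single (h.rung v) 1 + Finsupp.single (h.rung (σ v)) 1) 1 -
        monomial (Finsupp.single (h.side v) 1 + Finsupp.single (h.side (τ v)) 1) 1 :
          MvPolynomial G.edgeSet k) := by
  rw [ladderQuadric, edgeVar_of_mem k (h.adj_rung v), edgeVar_of_mem k (h.adj_rung (σ v)),
    edgeVar_of_mem k (h.adj_side v), edgeVar_of_mem k (h.adj_side (τ v))]
  simp only [X, monomial_mul, mul_one]
  rfl

theorem ladderQuadric_isHomogeneous (h : IsLadder G σ ρ τ) (k : Type*) [Field k] (v : V) :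
    (ladderQuadric k G σ τ v).IsHomogeneous 2 := by
  rw [h.ladderQuadric_eq]
  exact (isHomogeneous_monomial 1 (by simp)).sub (isHomogeneous_monomial 1 (by simp))

theorem ladderQuadric_rung (h : IsLadder G σ ρ τ) (k : Type*) [Field k] (v : V) :
    ladderQuadric k G σ τ (τ v) = ladderQuadric k G σ τ v := by
  simp only [ladderQuadric, h.invol, h.comm]
  rw [Sym2.eq_swap (a := τ v), Sym2.eq_swap (a := τ (σ v)),
    mul_comm (edgeVar k G s(τ v, τ (σ v)))]

theorem exists_eq_rung_or_side (h : IsLadder G σ ρ τ) (e : G.edgeSet) :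
    (∃ v, e = h.rung v) ∨ ∃ v, e = h.side v := by
  obtain ⟨e, he⟩ := e
  induction e using Sym2.ind with
  | _ v w =>
    rcases h.neighbor v w he with rfl | rfl | rfl
    · exact Or.inl ⟨v, rfl⟩
    · exact Or.inr ⟨v, rfl⟩
    · refine Or.inr ⟨ρ v, Subtype.ext ?_⟩
      simp only [side, h.right_inv]
      exact Sym2.eq_swap

variable [Fintype V]

/-- The distinct vertices `v` and `τ v` give the same quadric, so every fibre has at least two
elements. -/
theorem two_mul_ncard_range_le (h : IsLadder G σ ρ τ) (k : Type*) [Field k] :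
    2 * (Set.range (ladderQuadric k G σ τ)).ncard ≤ Fintype.card V := by
  classical
  have h1 : (Set.range (ladderQuadric k G σ τ)).ncard =
      (Finset.univ.image (ladderQuadric k G σ τ)).card := by
    rw [← Set.ncard_coe_finset]
    simp
  rw [h1, ← Finset.card_univ,
    Finset.card_eq_sum_card_image (ladderQuadric k G σ τ) Finset.univ, mul_comm]
  refine Finset.card_nsmul_le_sum _ _ 2 fun f hf => ?_
  obtain ⟨v, -, rfl⟩ := Finset.mem_image.1 hf
  refine Finset.one_lt_card.2 ⟨v, by simp, τ v, ?_, (h.adj_rung v).ne⟩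
  simp [h.ladderQuadric_rung]

theorem ladderQuadric_mem (h : IsLadder G σ ρ τ) [Fintype G.edgeSet] (k : Type*) [Field k] (v : V) :
    ladderQuadric k G σ τ v ∈ toricIdeal k (incidence G) := by
  rw [h.ladderQuadric_eq, binomial_mem_toricIdeal]
  have hadj : G.Adj (τ v) (τ (σ v)) := h.comm v ▸ h.adj_side (τ v)
  have h1 := mulVec_matching_eq (h.adj_rung v) (h.adj_rung (σ v)) (h.adj_side v) hadj
  have h2 : h.side (τ v) = ⟨s(τ v, τ (σ v)), hadj⟩ := by
    refine Subtype.ext ?_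
    simp only [side, h.comm]
  rw [h2]
  exact h1

variable [DecidableRel G.Adj]

theorem neighbors_ne (h : IsLadder G σ ρ τ) (hG : G.IsRegularOfDegree 3) (v : V) :
    τ v ≠ σ v ∧ τ v ≠ ρ v ∧ σ v ≠ ρ v := by
  classical
  have hsub : G.neighborFinset v ⊆ {τ v, σ v, ρ v} := by
    intro w hw
    simpa using h.neighbor v w (by simpa using hw)
  have hcard := Finset.card_le_card hsub
  rw [G.card_neighborFinset_eq_degree, hG.degree_eq] at hcard
  refine ⟨fun h' => ?_, fun h' => ?_, fun h' => ?_⟩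
  · rw [h', Finset.insert_eq_of_mem (by simp)] at hcard
    exact absurd (hcard.trans Finset.card_le_two) (by omega)
  · rw [h', Finset.insert_eq_of_mem (by simp)] at hcard
    exact absurd (hcard.trans Finset.card_le_two) (by omega)
  · rw [h', Finset.pair_eq_singleton] at hcard
    exact absurd (hcard.trans Finset.card_le_two) (by omega)

theorem side_ne_side (h : IsLadder G σ ρ τ) (hG : G.IsRegularOfDegree 3) (v : V) :
    h.side v ≠ h.side (τ v) := by
  intro h'
  rcases Sym2.eq_iff.1 (congrArg Subtype.val h') with h1 | h1
  · exact (h.adj_rung v).ne h1.1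
  · exact (h.neighbors_ne hG v).1 h1.2.symm

theorem rung_ne_side (h : IsLadder G σ ρ τ) (hG : G.IsRegularOfDegree 3) (v w : V) :
    h.rung v ≠ h.side w := by
  intro h'
  rcases Sym2.eq_iff.1 (congrArg Subtype.val h') with ⟨rfl, h1⟩ | ⟨h1, h2⟩
  · exact (h.neighbors_ne hG v).1 h1
  · subst h2
    refine (h.neighbors_ne hG v).2.1 ?_
    have := congrArg ρ h1
    rw [h.left_inv] at this
    exact this.symm

/-- Modulo the quadrics each monomial equals one that contains no pair of opposite sides. -/
theorem exists_reduced (h : IsLadder G σ ρ τ) (k : Type*) [Field k]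
    (hG : G.IsRegularOfDegree 3) (N : ℕ) : ∀ α : G.edgeSet →₀ ℕ,
    ∑ v, α (h.side v) = N → ∃ β : G.edgeSet →₀ ℕ,
      (∀ v, β (h.side v) = 0 ∨ β (h.side (τ v)) = 0) ∧
      (monomial α 1 - monomial β 1 : MvPolynomial G.edgeSet k) ∈
        Ideal.span (Set.range (ladderQuadric k G σ τ)) := by
  classical
  induction N using Nat.strong_induction_on with
  | _ N ih =>
    intro α hα
    by_cases hred : ∀ v, α (h.side v) = 0 ∨ α (h.side (τ v)) = 0
    · exact ⟨α, hred, by simp⟩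
    push Not at hred
    obtain ⟨v, hv1, hv2⟩ := hred
    have hle : Finsupp.single (h.side v) 1 + Finsupp.single (h.side (τ v)) 1 ≤ α := by
      intro e
      have hne := h.side_ne_side hG v
      simp only [Finsupp.coe_add, Pi.add_apply, Finsupp.single_apply]
      by_cases h1 : h.side v = e
      · subst h1
        rw [if_pos rfl, if_neg hne.symm]
        omega
      · rw [if_neg h1]
        by_cases h2 : h.side (τ v) = e
        · subst h2
          rw [if_pos rfl]
          omega
        · simp [h2]
    obtain ⟨γ, rfl⟩ := exists_add_of_le hle
    -- Trading two opposite sides for two rungs lowers the total exponent of the sides, so the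
    -- rewriting terminates.
    have hlt : ∑ w, (Finsupp.single (h.rung v) 1 + Finsupp.single (h.rung (σ v)) 1 + γ :
        G.edgeSet →₀ ℕ) (h.side w) < N := by
      rw [← hα]
      refine Finset.sum_lt_sum (fun w _ => ?_) ⟨v, Finset.mem_univ v, ?_⟩
      · simp [Finsupp.single_apply, h.rung_ne_side hG]
      · simp [Finsupp.single_apply, h.rung_ne_side hG]
    obtain ⟨β, hβ, hmem⟩ := ih _ hlt _ rfl
    refine ⟨β, hβ, ?_⟩
    have hq : ladderQuadric k G σ τ v ∈ Ideal.span (Set.range (ladderQuadric k G σ τ)) :=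
      Ideal.subset_span ⟨v, rfl⟩
    have := sub_mem hmem (Ideal.mul_mem_left _ (monomial γ 1) hq)
    rw [h.ladderQuadric_eq] at this
    simp only [mul_sub, monomial_mul, mul_one] at this
    convert this using 1
    rw [add_comm γ (Finsupp.single (h.rung v) 1 + Finsupp.single (h.rung (σ v)) 1),
      add_comm γ (Finsupp.single (h.side v) 1 + Finsupp.single (h.side (τ v)) 1)]
    ring

variable [Fintype G.edgeSet]

theorem relation_at (h : IsLadder G σ ρ τ) (hG : G.IsRegularOfDegree 3) {u : G.edgeSet → ℤ}
    (hu : u ∈ relationLattice (incidence G)) (v : V) :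
    u (h.rung v) + u (h.side v) + u (h.side (ρ v)) = 0 := by
  obtain ⟨h1, h2, h3⟩ := h.neighbors_ne hG v
  have h4 := mem_relationLattice_incidence.1 hu v
  rw [sum_edgeExtend_eq h1 h2 h3 (h.neighbor v), edgeExtend_of_mem u (h.adj_rung v),
    edgeExtend_of_mem u (h.adj_side v), edgeExtend_of_mem u (h.adj_inv v)] at h4
  have h5 : h.side (ρ v) = ⟨s(v, ρ v), h.adj_inv v⟩ := by
    refine Subtype.ext ?_
    simp only [side, h.right_inv]
    exact Sym2.eq_swap
  rw [h5]
  exact h4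

/-- Subtracting the relations at the two ends of a rung shows that the difference of opposite sides
changes sign under `σ`. An odd power fixing `v` makes it its own negative. So does an even power
reaching `τ v`, since exchanging the ends of the rung also negates the difference. -/
theorem side_eq_side (h : IsLadder G σ ρ τ) (hG : G.IsRegularOfDegree 3) {u : G.edgeSet → ℤ}
    (hu : u ∈ relationLattice (incidence G)) (v : V) : u (h.side v) = u (h.side (τ v)) := by
  have hstep : ∀ v, u (h.side (σ v)) - u (h.side (τ (σ v))) =
      -(u (h.side v) - u (h.side (τ v))) := by
    intro v
    have h1 := h.relation_at hG hu (σ v)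
    have h2 := h.relation_at hG hu (τ (σ v))
    have h3 : h.rung (τ (σ v)) = h.rung (σ v) := by
      refine Subtype.ext ?_
      simp only [rung, h.invol]
      exact Sym2.eq_swap
    rw [h3, h.comm_inv, h.left_inv] at h2
    rw [h.left_inv] at h1
    linarith
  have hiter : ∀ r v, u (h.side (σ^[r] v)) - u (h.side (τ (σ^[r] v))) =
      (-1) ^ r * (u (h.side v) - u (h.side (τ v))) := by
    intro r
    induction r with
    | zero => simp
    | succ r ih =>
      intro v
      rw [Function.iterate_succ_apply', hstep, ih]
      ring
  obtain ⟨r, ⟨hr, hv⟩ | ⟨hr, hv⟩⟩ := h.parity v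
  · have := hiter r v
    rw [hv, hr.neg_one_pow] at this
    linarith
  · have := hiter r v
    rw [hv, hr.neg_one_pow, h.invol] at this
    linarith

theorem eq_zero_of_side_eq_zero (h : IsLadder G σ ρ τ) (hG : G.IsRegularOfDegree 3)
    {u : G.edgeSet → ℤ} (hu : u ∈ relationLattice (incidence G)) (h0 : ∀ v, u (h.side v) = 0) :
    u = 0 := by
  ext e
  rcases h.exists_eq_rung_or_side e with ⟨v, rfl⟩ | ⟨v, rfl⟩
  · have := h.relation_at hG hu v
    rw [h0, h0] at this
    simpa using this
  · exact h0 v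

variable (k : Type*) [Field k]

/-- Both monomials of a toric binomial can be reduced. The difference of the reduced exponents
agrees on opposite sides; since each monomial omits one side of every pair, it vanishes on sides,
hence also on rungs. -/
theorem span_ladderQuadric (h : IsLadder G σ ρ τ) (hG : G.IsRegularOfDegree 3) :
    Ideal.span (Set.range (ladderQuadric k G σ τ)) = toricIdeal k (incidence G) := by
  have hle : Ideal.span (Set.range (ladderQuadric k G σ τ)) ≤ toricIdeal k (incidence G) := by
    rw [Ideal.span_le]
    rintro _ ⟨v, rfl⟩
    exact h.ladderQuadric_mem k v
  refine le_antisymm hle ?_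
  rw [toricIdeal_eq_span, Ideal.span_le]
  rintro _ ⟨α, β, hαβ, rfl⟩
  obtain ⟨α', hα', h1⟩ := h.exists_reduced k hG _ α rfl
  obtain ⟨β', hβ', h2⟩ := h.exists_reduced k hG _ β rfl
  have h3 := binomial_mem_toricIdeal.1 (hle h1)
  have h4 := binomial_mem_toricIdeal.1 (hle h2)
  have hu : expDiff α' β' ∈ relationLattice (incidence G) :=
    mulVec_eq_iff.1 (h3.symm.trans (hαβ.trans h4))
  have h0 : expDiff α' β' = 0 := by
    refine h.eq_zero_of_side_eq_zero hG hu fun v => ?_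
    have h5 := h.side_eq_side hG hu v
    have h6 := hα' v
    have h7 := hβ' v
    simp only [expDiff] at h5 ⊢
    omega
  have heq : α' = β' := by
    ext e
    have := congrFun h0 e
    simp only [expDiff, Pi.zero_apply] at this
    omega
  subst heq
  have := sub_mem h1 h2
  rwa [sub_sub_sub_cancel_right] at this

/-- The quadrics of a ladder form a minimal set of generators. -/
theorem isMinimalGeneratingSet (h : IsLadder G σ ρ τ) (hG : G.IsRegularOfDegree 3) :
    IsMinimalGeneratingSet (graphIdeal k G) (Set.range (ladderQuadric k G σ τ)) ∧
      2 * (Set.range (ladderQuadric k G σ τ)).ncard = Fintype.card V ∧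
      IsCompleteIntersection (graphIdeal k G) := by
  set Q := Set.range (ladderQuadric k G σ τ) with hQ
  have hspan : Ideal.span Q = graphIdeal k G := h.span_ladderQuadric k hG
  have hQfin : Q.Finite := Set.finite_range _
  have hne : graphIdeal k G ≠ ⊤ := (toricIdeal_isPrime (incidence G)).ne_top
  have h1 := h.two_mul_ncard_range_le k
  rw [← hQ] at h1
  have h2 := three_mul_card_eq hG
  have h3 := card_edgeSet_le_finrank_add (G := G)
  have h4 : (graphIdeal k G).height = Module.finrank ℤ (relationLattice (incidence G)) :=
    height_toricIdeal _
  have h5 : (graphIdeal k G).height ≤ (graphIdeal k G).spanFinrank :=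
    Ideal.height_le_spanFinrank _ hne
  have h6 : (graphIdeal k G).spanFinrank ≤ Q.ncard := by
    rw [← hspan]
    exact Submodule.spanFinrank_span_le_ncard_of_finite hQfin
  rw [h4] at h5
  have h5' : Module.finrank ℤ (relationLattice (incidence G)) ≤ (graphIdeal k G).spanFinrank := by
    exact_mod_cast h5
  have hle : ∀ T : Set (MvPolynomial G.edgeSet k), Ideal.span T = graphIdeal k G →
      Q.encard ≤ T.encard := by
    intro T hT
    rw [← hQfin.cast_ncard_eq]
    have h7 : ((graphIdeal k G).spanFinrank : ℕ∞) ≤ T.encard := by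
      rw [← hT]
      exact Submodule.spanFinrank_span_le_encard T
    refine le_trans ?_ h7
    have : Q.ncard ≤ (graphIdeal k G).spanFinrank := by omega
    exact_mod_cast this
  refine ⟨⟨hspan, fun T hT hT' => ?_, hle⟩, by omega, ?_⟩
  · exact absurd (hle T hT') (not_le.2 ((hQfin.subset hT.subset).encard_lt_encard hT))
  · rw [IsCompleteIntersection, h4]
    have : (graphIdeal k G).spanFinrank = Module.finrank ℤ (relationLattice (incidence G)) := by
      omega
    rw [this]

end IsLadder

end Ladder

/-! ### Odd bands and even Möbius bands as ladders. -/

section BandLadders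

variable {V : Type*} {G : SimpleGraph V} {n : ℕ} {a b : Fin (n + 1) → V}

/-- The two edges that close up the chain, to a Möbius band if `t` and to a band otherwise. -/
def closingEdges (t : Bool) (a b : Fin (n + 1) → V) : Set (Sym2 V) :=
  if t then {s(a 0, b (Fin.last n)), s(a (Fin.last n), b 0)}
  else {s(a 0, a (Fin.last n)), s(b 0, b (Fin.last n))}

/-- The values of the shift `σ` and of the rung involution `τ` on the vertices of a band. -/
structure IsBandShift (t : Bool) (a b : Fin (n + 1) → V) (σ τ : V → V) : Prop where
  rung : ∀ i, τ (a i) = b i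
  rung' : ∀ i, τ (b i) = a i
  shift : ∀ i : Fin n, σ (a i.castSucc) = a i.succ
  shift' : ∀ i : Fin n, σ (b i.castSucc) = b i.succ
  shift_last : σ (a (Fin.last n)) = if t then b 0 else a 0
  shift_last' : σ (b (Fin.last n)) = if t then a 0 else b 0

theorem exists_isBandShift (t : Bool) (hbij : Function.Bijective (Sum.elim a b)) :
    ∃ σ ρ τ : V → V, IsBandShift t a b σ τ ∧ (∀ v, ρ (σ v) = v) ∧ (∀ v, σ (ρ v) = v) ∧
      (∀ v, τ (τ v) = v) ∧ ∀ v, σ (τ v) = τ (σ v) := by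
  let e : Fin (n + 1) × Bool ≃ V :=
    ((Equiv.prodComm _ _).trans (Equiv.boolProdEquivSum _)).trans (Equiv.ofBijective _ hbij)
  have hea : ∀ i, e (i, false) = a i := fun i => rfl
  have heb : ∀ i, e (i, true) = b i := fun i => rfl
  have hea' : ∀ i, e.symm (a i) = (i, false) := fun i => by rw [← hea, e.symm_apply_apply]
  have heb' : ∀ i, e.symm (b i) = (i, true) := fun i => by rw [← heb, e.symm_apply_apply]
  -- Addition in `Fin (n + 1)` wraps from the last rung to the first; in the Möbius case exactly
  -- this step exchanges the `a` and `b` strands.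
  let σ₀ : Fin (n + 1) × Bool → Fin (n + 1) × Bool := fun x =>
    (x.1 + 1, x.2 ^^ (t && decide (x.1 = Fin.last n)))
  let ρ₀ : Fin (n + 1) × Bool → Fin (n + 1) × Bool := fun x =>
    (x.1 - 1, x.2 ^^ (t && decide (x.1 - 1 = Fin.last n)))
  refine ⟨fun v => e (σ₀ (e.symm v)), fun v => e (ρ₀ (e.symm v)),
    fun v => e ((e.symm v).1, !(e.symm v).2), ?_, ?_, ?_, ?_, ?_⟩
  · constructor
    · intro i; simp [hea', heb]
    · intro i; simp [heb', hea]
    · intro i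
      simp [hea', σ₀, (Fin.castSucc_lt_last i).ne, hea]
    · intro i
      simp [heb', σ₀, (Fin.castSucc_lt_last i).ne, heb]
    · cases t <;> simp [hea', σ₀, hea, heb]
    · cases t <;> simp [heb', σ₀, hea, heb]
  · intro v; simp [σ₀, ρ₀]
  · intro v; simp [σ₀, ρ₀]
  · intro v; simp
  · intro v; simp [σ₀]

theorem IsBandShift.iterate {t : Bool} {σ τ : V → V} (h : IsBandShift t a b σ τ) (i : ℕ) :
    ∀ hi : i < n + 1, σ^[i] (a 0) = a ⟨i, hi⟩ ∧ σ^[i] (b 0) = b ⟨i, hi⟩ := by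
  induction i with
  | zero => intro; exact ⟨rfl, rfl⟩
  | succ i ih =>
    intro hi
    obtain ⟨h1, h2⟩ := ih (by omega)
    rw [Function.iterate_succ_apply', Function.iterate_succ_apply', h1, h2]
    exact ⟨h.shift ⟨i, by omega⟩, h.shift' ⟨i, by omega⟩⟩

theorem exists_isLadder (t : Bool) (hbij : Function.Bijective (Sum.elim a b))
    (hE : G.edgeSet = chainEdges a b ∪ closingEdges t a b)
    (hpar : if t then Even (n + 1) else Odd (n + 1)) :
    ∃ σ ρ τ : V → V, IsLadder G σ ρ τ ∧ IsBandShift t a b σ τ := by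
  obtain ⟨σ, ρ, τ, h, h1, h2, h3, h4⟩ := exists_isBandShift t hbij
  refine ⟨σ, ρ, τ, ?_, h⟩
  have hsurj : ∀ v, ∃ i, v = a i ∨ v = b i := by
    intro v
    obtain ⟨i | i, hi⟩ := hbij.2 v
    exacts [⟨i, Or.inl hi.symm⟩, ⟨i, Or.inr hi.symm⟩]
  have hedge : ∀ e, e ∈ G.edgeSet ↔ (∃ v, e = s(v, τ v)) ∨ ∃ v, e = s(v, σ v) := by
    intro e
    rw [hE]
    constructor
    · rintro ((⟨i, rfl | rfl⟩ | ⟨j, rfl⟩) | he)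
      · exact Or.inr ⟨a i.castSucc, by rw [h.shift]⟩
      · exact Or.inr ⟨b i.castSucc, by rw [h.shift']⟩
      · exact Or.inl ⟨a j, by rw [h.rung]⟩
      · right
        have ha := h.shift_last
        have hb := h.shift_last'
        cases t
        · rcases he with rfl | rfl
          · exact ⟨a (Fin.last n), by rw [ha]; exact Sym2.eq_swap⟩
          · exact ⟨b (Fin.last n), by rw [hb]; exact Sym2.eq_swap⟩
        · rcases he with rfl | rfl
          · exact ⟨b (Fin.last n), by rw [hb]; exact Sym2.eq_swap⟩
          · exact ⟨a (Fin.last n), by rw [ha]; rfl⟩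
    · rintro (⟨v, rfl⟩ | ⟨v, rfl⟩)
      · obtain ⟨i, rfl | rfl⟩ := hsurj v
        · exact Or.inl (Or.inr ⟨i, by rw [h.rung]⟩)
        · exact Or.inl (Or.inr ⟨i, by rw [h.rung', Sym2.eq_swap]⟩)
      · obtain ⟨i, hi⟩ := hsurj v
        induction i using Fin.lastCases with
        | cast i =>
          rcases hi with rfl | rfl
          · exact Or.inl (Or.inl ⟨i, Or.inl (by rw [h.shift])⟩)
          · exact Or.inl (Or.inl ⟨i, Or.inr (by rw [h.shift'])⟩)
        | last =>
          right
          have ha := h.shift_last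
          have hb := h.shift_last'
          cases t <;> rcases hi with rfl | rfl
          · left; rw [ha]; exact Sym2.eq_swap
          · right; rw [hb]; exact Sym2.eq_swap
          · right; rw [ha]; rfl
          · left; rw [hb]; exact Sym2.eq_swap
  refine ⟨h1, h2, h3, h4, fun v => (hedge _).2 (Or.inl ⟨v, rfl⟩),
    fun v => (hedge _).2 (Or.inr ⟨v, rfl⟩), fun v w hvw => ?_, fun v => ⟨n + 1, ?_⟩⟩
  · rcases (hedge s(v, w)).1 hvw with ⟨x, hx⟩ | ⟨x, hx⟩
    · rcases Sym2.eq_iff.1 hx with ⟨rfl, rfl⟩ | ⟨rfl, rfl⟩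
      · exact Or.inl rfl
      · exact Or.inl (h3 w).symm
    · rcases Sym2.eq_iff.1 hx with ⟨rfl, rfl⟩ | ⟨rfl, rfl⟩
      · exact Or.inr (Or.inl rfl)
      · exact Or.inr (Or.inr (h1 w).symm)
  -- One full turn `σ^[n + 1]` fixes each vertex of a band and acts as `τ` on a Möbius band. It
  -- suffices to check `a 0` and `b 0`, since the turn commutes with powers of `σ`.
  · obtain ⟨l1, l2⟩ := h.iterate n (by omega)
    have ha0 : σ^[n + 1] (a 0) = if t then b 0 else a 0 := by
      rw [Function.iterate_succ_apply', l1]; exact h.shift_last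
    have hb0 : σ^[n + 1] (b 0) = if t then a 0 else b 0 := by
      rw [Function.iterate_succ_apply', l2]; exact h.shift_last'
    have hcomm : ∀ i x, σ^[n + 1] (σ^[i] x) = σ^[i] (σ^[n + 1] x) := fun i x => by
      rw [← Function.iterate_add_apply, ← Function.iterate_add_apply, Nat.add_comm]
    obtain ⟨⟨i, hi⟩, rfl | rfl⟩ := hsurj v
    · rw [← (h.iterate i hi).1, hcomm, ha0, (h.iterate i hi).1, h.rung]
      cases t
      · exact Or.inl ⟨hpar, (h.iterate i hi).1⟩
      · exact Or.inr ⟨hpar, (h.iterate i hi).2⟩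
    · rw [← (h.iterate i hi).2, hcomm, hb0, (h.iterate i hi).2, h.rung']
      cases t
      · exact Or.inl ⟨hpar, (h.iterate i hi).2⟩
      · exact Or.inr ⟨hpar, (h.iterate i hi).1⟩

theorem IsBand.exists_isLadder (h : IsBand G a b) (hn : Odd (n + 1)) :
    ∃ σ ρ τ : V → V, IsLadder G σ ρ τ ∧ IsBandShift false a b σ τ :=
  ToricGraph.exists_isLadder false h.bijective h.edgeSet_eq hn

theorem IsMobiusBand.exists_isLadder (h : IsMobiusBand G a b) (hn : Even (n + 1)) :
    ∃ σ ρ τ : V → V, IsLadder G σ ρ τ ∧ IsBandShift true a b σ τ :=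
  ToricGraph.exists_isLadder true h.bijective h.edgeSet_eq hn

end BandLadders

/-! ### Binomials of the explicit closed walks as ladder quadrics. -/

section Walks

variable (k : Type*) [Field k] {V : Type*} {G : SimpleGraph V}

theorem edgeVar_of_adj {p q : V} (h : G.Adj p q) :
    edgeVar k G s(p, q) = MvPolynomial.X ⟨s(p, q), h⟩ := edgeVar_of_mem k h

theorem walkBinomial_of_support {u v : V} {w : G.Walk u v} {p q r s t : V}
    (hw : w.support = [p, q, r, s, t]) :
    walkBinomial k w = edgeVar k G s(p, q) * edgeVar k G s(r, s) -
      edgeVar k G s(q, r) * edgeVar k G s(s, t) := by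
  cases w with
  | nil => simp at hw
  | cons h₁ w =>
  cases w with
  | nil => simp at hw
  | cons h₂ w =>
  cases w with
  | nil => simp at hw
  | cons h₃ w =>
  cases w with
  | nil => simp at hw
  | cons h₄ w =>
  cases w with
  | cons h₅ w => simp at hw
  | nil =>
    simp only [SimpleGraph.Walk.support_cons, SimpleGraph.Walk.support_nil, List.cons.injEq,
      and_true] at hw
    obtain ⟨rfl, rfl, rfl, rfl, rfl⟩ := hw
    rw [edgeVar_of_adj k h₁, edgeVar_of_adj k h₂, edgeVar_of_adj k h₃, edgeVar_of_adj k h₄]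
    simp [walkBinomial, walkMonomials]

theorem exists_walk_of_adj {p q r s : V} (h₁ : G.Adj p q) (h₂ : G.Adj q r) (h₃ : G.Adj r s)
    (h₄ : G.Adj s p) : ∃ (u : V) (w : G.Walk u u), w.support = [p, q, r, s, p] :=
  ⟨p, .cons h₁ (.cons h₂ (.cons h₃ (.cons h₄ .nil))), rfl⟩

variable {n : ℕ} {a b : Fin (n + 1) → V} {σ ρ τ : V → V}

/-- The walk through the closing edges begins at the first rung, whereas its ladder quadric is
indexed by the last vertex `a n`. In both, the rungs form the positive term, so no sign appears. The
vertices `c` and `d` are the ends of the last rung in the order of that walk, which depends on `t`.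
-/
theorem quadrics_eq_range {t : Bool} (hl : IsLadder G σ ρ τ) (hs : IsBandShift t a b σ τ)
    {c d : V} (hc : c = if t then a (Fin.last n) else b (Fin.last n))
    (hd : d = if t then b (Fin.last n) else a (Fin.last n)) :
    {f | ∃ (u : V) (w : G.Walk u u), f = walkBinomial k w ∧
      ((∃ i : Fin n, w.support = [a i.castSucc, b i.castSucc, b i.succ, a i.succ, a i.castSucc]) ∨
        w.support = [a 0, b 0, c, d, a 0])} =
      Set.range fun i => ladderQuadric k G σ τ (a i) := by
  have hq : ∀ i : Fin n, ladderQuadric k G σ τ (a i.castSucc) =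
      edgeVar k G s(a i.castSucc, b i.castSucc) * edgeVar k G s(b i.succ, a i.succ) -
        edgeVar k G s(b i.castSucc, b i.succ) * edgeVar k G s(a i.succ, a i.castSucc) := by
    intro i
    rw [ladderQuadric, hs.rung, hs.shift, hs.rung, hs.shift', Sym2.eq_swap (a := b i.succ),
      Sym2.eq_swap (a := a i.succ) (b := a i.castSucc), mul_comm (edgeVar k G s(b i.castSucc, _))]
  have hqlast : ladderQuadric k G σ τ (a (Fin.last n)) =
      edgeVar k G s(a 0, b 0) * edgeVar k G s(c, d) -
        edgeVar k G s(b 0, c) * edgeVar k G s(d, a 0) := by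
    rw [ladderQuadric, hs.rung, hs.shift_last, hs.shift_last']
    subst hc hd
    cases t
    · simp only [Bool.false_eq_true, if_false, hs.rung]
      rw [Sym2.eq_swap (a := b (Fin.last n)) (b := a (Fin.last n)),
        Sym2.eq_swap (a := b 0) (b := b (Fin.last n))]
      ring
    · simp only [if_true, hs.rung']
      rw [Sym2.eq_swap (a := b 0) (b := a 0), Sym2.eq_swap (a := b 0) (b := a (Fin.last n))]
      ring
  ext f
  constructor
  · rintro ⟨u, w, rfl, ⟨i, hw⟩ | hw⟩
    · exact ⟨i.castSucc, by rw [walkBinomial_of_support k hw]; exact hq i⟩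
    · exact ⟨Fin.last n, by rw [walkBinomial_of_support k hw]; exact hqlast⟩
  · rintro ⟨i, rfl⟩
    have hab : ∀ i, G.Adj (a i) (b i) := fun i => hs.rung i ▸ hl.adj_rung (a i)
    induction i using Fin.lastCases with
    | cast i =>
      obtain ⟨u, w, hw⟩ := exists_walk_of_adj (hab i.castSucc)
        (hs.shift' i ▸ hl.adj_side (b i.castSucc)) (hab i.succ).symm
        (hs.shift i ▸ hl.adj_side (a i.castSucc)).symm
      exact ⟨u, w, by rw [walkBinomial_of_support k hw]; exact hq i, Or.inl ⟨i, hw⟩⟩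
    | last =>
      have h1 := hl.adj_side (a (Fin.last n))
      have h2 := hl.adj_side (b (Fin.last n))
      rw [hs.shift_last] at h1
      rw [hs.shift_last'] at h2
      obtain ⟨u, w, hw⟩ : ∃ (u : V) (w : G.Walk u u), w.support = [a 0, b 0, c, d, a 0] := by
        subst hc hd
        cases t
        · exact exists_walk_of_adj (hab 0) h2.symm (hab _).symm h1
        · exact exists_walk_of_adj (hab 0) h1.symm (hab _) h2
      exact ⟨u, w, by rw [walkBinomial_of_support k hw]; exact hqlast, Or.inr hw⟩

theorem bandQuadrics_eq_range (hl : IsLadder G σ ρ τ) (hs : IsBandShift false a b σ τ) :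
    bandQuadrics k G a b = Set.range fun i => ladderQuadric k G σ τ (a i) :=
  quadrics_eq_range k hl hs rfl rfl

theorem mobiusQuadrics_eq_range (hl : IsLadder G σ ρ τ) (hs : IsBandShift true a b σ τ) :
    mobiusQuadrics k G a b = Set.range fun i => ladderQuadric k G σ τ (a i) :=
  quadrics_eq_range k hl hs rfl rfl

theorem range_ladderQuadric_eq {t : Bool} (hl : IsLadder G σ ρ τ) (hs : IsBandShift t a b σ τ)
    (hbij : Function.Bijective (Sum.elim a b)) :
    (Set.range fun i => ladderQuadric k G σ τ (a i)) = Set.range (ladderQuadric k G σ τ) := by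
  refine Set.Subset.antisymm (by rintro _ ⟨i, rfl⟩; exact ⟨a i, rfl⟩) ?_
  rintro _ ⟨v, rfl⟩
  obtain ⟨i | i, rfl⟩ := hbij.2 v
  · exact ⟨i, rfl⟩
  · refine ⟨i, ?_⟩
    simp only [Sum.elim_inr]
    rw [← hs.rung, hl.ladderQuadric_rung]

end Walks

/-! ### Gluing ladders over the connected components. -/

section ComponentLadders

variable {V : Type*} {G : SimpleGraph V}

/-- Ladder structures on the components of a graph form a ladder structure on the graph. -/
theorem exists_isLadder_of_components {σ ρ τ : ∀ c : G.ConnectedComponent, c → c}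
    (h : ∀ c, IsLadder c.toSimpleGraph (σ c) (ρ c) (τ c)) :
    ∃ σ' ρ' τ' : V → V, IsLadder G σ' ρ' τ' ∧
      ∀ (c : G.ConnectedComponent) (x : c), σ' x = σ c x ∧ τ' x = τ c x := by
  obtain ⟨glue, hglue⟩ : ∃ glue : (∀ c : G.ConnectedComponent, c → c) → V → V,
      ∀ f (c : G.ConnectedComponent) (x : c), glue f x = f c x := by
    refine ⟨fun f v => f (G.connectedComponentMk v) ⟨v, rfl⟩, ?_⟩
    rintro f c ⟨v, hv⟩
    obtain rfl : G.connectedComponentMk v = c := hv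
    rfl
  have hrep : ∀ v : V, ∃ (c : G.ConnectedComponent) (x : c), v = x :=
    fun v => ⟨G.connectedComponentMk v, ⟨v, rfl⟩, rfl⟩
  refine ⟨glue σ, glue ρ, glue τ, ?_, fun c x => ⟨hglue σ c x, hglue τ c x⟩⟩
  constructor
  · intro v
    obtain ⟨c, x, rfl⟩ := hrep v
    rw [hglue, hglue, (h c).left_inv]
  · intro v
    obtain ⟨c, x, rfl⟩ := hrep v
    rw [hglue, hglue, (h c).right_inv]
  · intro v
    obtain ⟨c, x, rfl⟩ := hrep v
    rw [hglue, hglue, (h c).invol]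
  · intro v
    obtain ⟨c, x, rfl⟩ := hrep v
    rw [hglue, hglue, hglue, hglue, (h c).comm]
  · intro v
    obtain ⟨c, x, rfl⟩ := hrep v
    rw [hglue]
    exact (h c).adj_rung x
  · intro v
    obtain ⟨c, x, rfl⟩ := hrep v
    rw [hglue]
    exact (h c).adj_side x
  · intro v w hvw
    obtain ⟨c, x, rfl⟩ := hrep v
    have hw : w ∈ c.supp := (SimpleGraph.ConnectedComponent.mem_supp_congr_adj c hvw).1 x.2
    rw [hglue, hglue, hglue]
    have := (h c).neighbor x ⟨w, hw⟩ hvw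
    simpa only [Subtype.ext_iff] using this
  · intro v
    obtain ⟨c, x, rfl⟩ := hrep v
    have hiter : ∀ r, (glue σ)^[r] x = ((σ c)^[r] x : c) := by
      intro r
      induction r with
      | zero => rfl
      | succ r ih => rw [Function.iterate_succ_apply', Function.iterate_succ_apply', ih, hglue]
    obtain ⟨r, hr⟩ := (h c).parity x
    refine ⟨r, ?_⟩
    rw [hiter, hglue]
    simpa only [Subtype.ext_iff] using hr

theorem IsBandShift.ofComponent {c : G.ConnectedComponent} {n : ℕ} {a b : Fin (n + 1) → c}
    {t : Bool} {σ τ : c → c} (h : IsBandShift t a b σ τ) {σ' τ' : V → V}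
    (hσ : ∀ x : c, σ' x = σ x) (hτ : ∀ x : c, τ' x = τ x) :
    IsBandShift t (fun i => (a i : V)) (fun i => (b i : V)) σ' τ' := by
  constructor
  · intro i; rw [hτ, h.rung]
  · intro i; rw [hτ, h.rung']
  · intro i; rw [hσ, h.shift]
  · intro i; rw [hσ, h.shift']
  · rw [hσ, h.shift_last]; cases t <;> rfl
  · rw [hσ, h.shift_last']; cases t <;> rfl

/-- The quadrics of the components of `G` are the quadrics of a ladder structure on `G`. -/
theorem exists_isLadder_of_isComponentQuadrics {k : Type*} [Field k]
    {S : G.ConnectedComponent → Set (MvPolynomial G.edgeSet k)}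
    (hS : ∀ c, IsComponentQuadrics k c (S c)) :
    ∃ σ ρ τ : V → V, IsLadder G σ ρ τ ∧ ⋃ c, S c = Set.range (ladderQuadric k G σ τ) := by
  -- The quadrics live in the polynomial ring of `G`, so `S c` is described through an arbitrary
  -- ladder on `G` extending that of `c`; the glued ladder is available only once all components
  -- have theirs.
  have key : ∀ c : G.ConnectedComponent, ∃ σ ρ τ : c → c,
      IsLadder c.toSimpleGraph σ ρ τ ∧ ∀ σ' ρ' τ' : V → V, IsLadder G σ' ρ' τ' →
        (∀ x : c, σ' x = σ x ∧ τ' x = τ x) → S c = (ladderQuadric k G σ' τ') '' c.supp := by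
    intro c
    have hrange : ∀ {n : ℕ} {a b : Fin (n + 1) → c} {t : Bool} {σ' ρ' τ' : V → V},
        IsLadder G σ' ρ' τ' → IsBandShift t (fun i => (a i : V)) (fun i => (b i : V)) σ' τ' →
        Function.Bijective (Sum.elim a b) →
        (Set.range fun i => ladderQuadric k G σ' τ' (a i)) =
          (ladderQuadric k G σ' τ') '' c.supp := by
      intro n a b t σ' ρ' τ' hl hs hbij
      refine Set.Subset.antisymm (by rintro _ ⟨i, rfl⟩; exact ⟨a i, (a i).2, rfl⟩) ?_
      rintro _ ⟨v, hv, rfl⟩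
      obtain ⟨i | i, hi⟩ := hbij.2 ⟨v, hv⟩
      · exact ⟨i, by rw [show v = a i from congrArg Subtype.val hi.symm]⟩
      · refine ⟨i, ?_⟩
        have h1 : v = τ' (a i) := (congrArg Subtype.val hi.symm).trans (hs.rung i).symm
        rw [h1, hl.ladderQuadric_rung]
    obtain ⟨n, a, b, ⟨hn, hb, hSc⟩ | ⟨hn, hb, hSc⟩⟩ := hS c
    · obtain ⟨σ, ρ, τ, hl, hs⟩ := hb.exists_isLadder hn
      refine ⟨σ, ρ, τ, hl, fun σ' ρ' τ' hl' hx => ?_⟩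
      have hs' := hs.ofComponent (fun x => (hx x).1) (fun x => (hx x).2)
      rw [hSc, bandQuadrics_eq_range k hl' hs', hrange hl' hs' hb.bijective]
    · obtain ⟨σ, ρ, τ, hl, hs⟩ := hb.exists_isLadder hn
      refine ⟨σ, ρ, τ, hl, fun σ' ρ' τ' hl' hx => ?_⟩
      have hs' := hs.ofComponent (fun x => (hx x).1) (fun x => (hx x).2)
      rw [hSc, mobiusQuadrics_eq_range k hl' hs', hrange hl' hs' hb.bijective]
  choose σ ρ τ hl hSc using key
  obtain ⟨σ', ρ', τ', hl', hx⟩ := exists_isLadder_of_components hl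
  refine ⟨σ', ρ', τ', hl', ?_⟩
  rw [Set.iUnion_congr fun c => hSc c σ' ρ' τ' hl' (hx c), ← Set.image_iUnion,
    SimpleGraph.iUnion_connectedComponentSupp, Set.image_univ]

end ComponentLadders

/-! ### Counting the quadrics of a single band and the final theorem. -/

section Main

variable (k : Type*) [Field k] {V : Type*} [Fintype V] {G : SimpleGraph V} [DecidableRel G.Adj]

theorem IsLadder.isMinimalGeneratingSet_of_isBandShift {n : ℕ} {a b : Fin (n + 1) → V} {t : Bool}
    {σ ρ τ : V → V} (hG : G.IsRegularOfDegree 3) (hl : IsLadder G σ ρ τ)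
    (hs : IsBandShift t a b σ τ) (hbij : Function.Bijective (Sum.elim a b))
    {Q : Set (MvPolynomial G.edgeSet k)}
    (hQ : Q = Set.range fun i => ladderQuadric k G σ τ (a i)) :
    IsMinimalGeneratingSet (graphIdeal k G) Q ∧ (∀ f ∈ Q, f.IsHomogeneous 2) ∧
      Q.encard = ((n + 1 : ℕ) : ℕ∞) := by
  classical
  rw [range_ladderQuadric_eq k hl hs hbij] at hQ
  subst hQ
  obtain ⟨h1, h2, -⟩ := hl.isMinimalGeneratingSet k hG
  refine ⟨h1, by rintro _ ⟨v, rfl⟩; exact hl.ladderQuadric_isHomogeneous k v, ?_⟩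
  have hcard : Fintype.card V = (n + 1) + (n + 1) := by
    rw [← Fintype.card_congr (Equiv.ofBijective _ hbij)]
    simp
  rw [← (Set.finite_range _).cast_ncard_eq]
  congr 1
  omega

end Main

end ToricGraph

theorem mainTheorem6 (k : Type*) [Field k] {V : Type*} [Fintype V]
    (G : SimpleGraph V) [DecidableRel G.Adj] (hG : G.IsRegularOfDegree 3) :
    -- the characterization
    (ToricGraph.IsCompleteIntersection (ToricGraph.graphIdeal k G) ↔
      ∀ c : G.ConnectedComponent,
        ToricGraph.IsOddBand c.toSimpleGraph ∨ ToricGraph.IsEvenMobiusBand c.toSimpleGraph) ∧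
    -- the generators when `G` is an odd band
    (∀ (n : ℕ) (a b : Fin (n + 1) → V), Odd (n + 1) → ToricGraph.IsBand G a b →
      ToricGraph.IsMinimalGeneratingSet (ToricGraph.graphIdeal k G)
          (ToricGraph.bandQuadrics k G a b) ∧
        (∀ f ∈ ToricGraph.bandQuadrics k G a b, f.IsHomogeneous 2) ∧
        (ToricGraph.bandQuadrics k G a b).encard = ((n + 1 : ℕ) : ℕ∞)) ∧
    -- the generators when `G` is an even Möbius band
    (∀ (n : ℕ) (a b : Fin (n + 1) → V), Even (n + 1) → ToricGraph.IsMobiusBand G a b →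
      ToricGraph.IsMinimalGeneratingSet (ToricGraph.graphIdeal k G)
          (ToricGraph.mobiusQuadrics k G a b) ∧
        (∀ f ∈ ToricGraph.mobiusQuadrics k G a b, f.IsHomogeneous 2) ∧
        (ToricGraph.mobiusQuadrics k G a b).encard = ((n + 1 : ℕ) : ℕ∞)) ∧
    -- the generators in general: the union over the connected components
    (∀ S : G.ConnectedComponent → Set (MvPolynomial G.edgeSet k),
      (∀ c, ToricGraph.IsComponentQuadrics k c (S c)) →
        ToricGraph.IsMinimalGeneratingSet (ToricGraph.graphIdeal k G) (⋃ c, S c) ∧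
          ∀ f ∈ ⋃ c, S c, f.IsHomogeneous 2) := by
  classical
  refine ⟨⟨?_, ?_⟩, ?_, ?_, ?_⟩
  · exact ToricGraph.isOddBand_or_isEvenMobiusBand_of_isCompleteIntersection hG
  -- Any labellings of the components glue to one ladder on `G`, whose quadrics number exactly the
  -- height.
  · intro h
    have hS : ∀ c : G.ConnectedComponent, ∃ S : Set (MvPolynomial G.edgeSet k),
        ToricGraph.IsComponentQuadrics k c S := by
      intro c
      rcases h c with ⟨n, a, b, hn, hb⟩ | ⟨n, a, b, hn, hb⟩
      · exact ⟨_, n, a, b, Or.inl ⟨hn, hb, rfl⟩⟩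
      · exact ⟨_, n, a, b, Or.inr ⟨hn, hb, rfl⟩⟩
    choose S hS using hS
    obtain ⟨σ, ρ, τ, hl, -⟩ := ToricGraph.exists_isLadder_of_isComponentQuadrics hS
    exact (hl.isMinimalGeneratingSet k hG).2.2
  · intro n a b hn hb
    obtain ⟨σ, ρ, τ, hl, hs⟩ := hb.exists_isLadder hn
    exact hl.isMinimalGeneratingSet_of_isBandShift k hG hs hb.bijective
      (ToricGraph.bandQuadrics_eq_range k hl hs)
  · intro n a b hn hb
    obtain ⟨σ, ρ, τ, hl, hs⟩ := hb.exists_isLadder hn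
    exact hl.isMinimalGeneratingSet_of_isBandShift k hG hs hb.bijective
      (ToricGraph.mobiusQuadrics_eq_range k hl hs)
  · intro S hS
    obtain ⟨σ, ρ, τ, hl, hSQ⟩ := ToricGraph.exists_isLadder_of_isComponentQuadrics hS
    rw [hSQ]
    refine ⟨(hl.isMinimalGeneratingSet k hG).1, ?_⟩
    rintro _ ⟨v, rfl⟩
    exact hl.ladderQuadric_isHomogeneous k v
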